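/- Let $G$ be a finite group. Let $\mathscr{O}_G$ be its orbit category (transitive nonempty finite $G$-sets and $G$-maps). A coefficient system is a functor $\mathscr{O}_G^{op}\to Ab$; it extends to finite $G$-sets by $A(\coprod_i \omega_i)=\bigoplus_i A(\omega_i)$ for orbits $\omega_i$. For coefficient systems $A,B$, let $A\boxtimes B$ be the restriction to $\mathscr{O}_G^{op}$ of the left Kan extension of $(S,T)\mapsto A(S)\otimes_{\mathbb Z} B(T)$ along the cartesian product functor $(\text{f.}G\text{-Sets})^{op}\times(\text{f.}G\text{-Sets})^{op}\to(\text{f.}G\text{-Sets})^{op}$. Let $\mathscr{B}_G$ be the Burnside category: its objects are finite $G$-sets, and $\mathscr{B}_G(T,U)$ is the group completion of the monoid, under disjoint union, of isomorphism classes of diagrams $T\leftarrow S\rightarrow U$ of finite $G$-sets; composition is by fibre product. A Mackey functor is an additive functor $\mathscr{B}_G\to Ab$, and $Mackey_G$ is the category of Mackey functors and natural transformations. For Mackey functors $M,N$, let $M\,\Box\,N$ be the left Kan extension, in additive functors, of $(S,T)\mapsto M(S)\otimes_{\mathbb Z} N(T)$ along the biadditive cartesian product $\times:\mathscr{B}_G\times\mathscr{B}_G\to\mathscr{B}_G$;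 that is, $M\,\Box\,N$ is the Mackey functor corepresenting $P\mapsto \mathrm{Nat}\big(M(-)\otimes N(-),\,P(-\times -)\big)$ on $Mackey_G$. Let $L: Funct(\mathscr{O}_G^{op},Ab)\to Mackey_G$ be the left Kan extension in additive functors, i.e. the left adjoint of restriction along the functor $\mathscr{O}_G^{op}\to\mathscr{B}_G$ that is the identity on objects and sends $f:S\to T$ to the class of $T\xleftarrow{\,f\,}S\xrightarrow{\,=\,}S$. Then $L$ takes $\boxtimes$ to $\Box$: there is an isomorphism of Mackey functors $$L(A\boxtimes B)\;\cong\; L(A)\,\Box\,L(B),$$ natural in the coefficient systems $A$ and $B$. -/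

import Mathlib

open CategoryTheory Limits
open scoped TensorProduct
universe w u

/-- The category of finite `G`-sets and `G`-maps. -/
abbrev FinGSet (G : Type u) [Group G] := Action FintypeCat.{u} G

namespace FinGSet

variable {G : Type u} [Group G]

/-- A finite type with a `G`-action, as a finite `G`-set. -/
abbrev of (X : Type u) [Finite X] [MulAction G X] : FinGSet G :=
  @Action.FintypeCat.ofMulAction G (FintypeCat.of X) _ (inferInstanceAs (MulAction G X))

/-- The underlying map of a morphism of finite `G`-sets. -/
def fn {S T : FinGSet G} (f : S ⟶ T) : S.V → T.V := fun x => ConcreteCategory.hom f.hom x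

/-- An equivariant map, as a morphism of finite `G`-sets. -/
def homMk {S T : FinGSet G} (f : S.V → T.V) (hf : ∀ (g : G) (x : S.V), f (g • x) = g • f x) :
    S ⟶ T where
  hom := FintypeCat.homMk f
  comm g := by
    ext x
    exact hf g x

@[simp] theorem fn_homMk {S T : FinGSet G} (f : S.V → T.V) (hf) (x : S.V) :
    fn (homMk (S := S) (T := T) f hf) x = f x := rfl

@[simp] theorem fn_id (S : FinGSet G) (x : S.V) : fn (𝟙 S) x = x := rfl

@[simp] theorem fn_comp {S T U : FinGSet G} (f : S ⟶ T) (g : T ⟶ U) (x : S.V) :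
    fn (f ≫ g) x = fn g (fn f x) := rfl

@[simp] theorem fn_smul {S T : FinGSet G} (f : S ⟶ T) (g : G) (x : S.V) :
    fn f (g • x) = g • fn f x :=
  ConcreteCategory.congr_hom (f.comm g) x

theorem hom_ext {S T : FinGSet G} {f g : S ⟶ T} (h : ∀ x, fn f x = fn g x) : f = g := by
  apply Action.hom_ext
  ext x
  exact h x

/-- An equivariant bijection, as an isomorphism of finite `G`-sets. -/
def isoMk {S T : FinGSet G} (e : S.V ≃ T.V) (he : ∀ (g : G) (x : S.V), e (g • x) = g • e x) :
    S ≅ T where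
  hom := homMk e he
  inv := homMk e.symm fun g x => by rw [Equiv.symm_apply_eq, he, Equiv.apply_symm_apply]
  hom_inv_id := hom_ext fun x => e.symm_apply_apply x
  inv_hom_id := hom_ext fun x => e.apply_symm_apply x

/-- The underlying bijection of an isomorphism of finite `G`-sets. -/
def equivOfIso {S T : FinGSet G} (e : S ≅ T) : S.V ≃ T.V where
  toFun := fn e.hom
  invFun := fn e.inv
  left_inv x := by rw [← fn_comp, e.hom_inv_id, fn_id]
  right_inv x := by rw [← fn_comp, e.inv_hom_id, fn_id]

/-- The empty `G`-set. -/
def emptyObj : FinGSet G :=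
  letI : MulAction G PEmpty.{u + 1} :=
    { smul := fun _ x => x, one_smul := fun x => x.elim, mul_smul := fun _ _ x => x.elim }
  of PEmpty.{u + 1}

instance : IsEmpty (emptyObj : FinGSet G).V := inferInstanceAs (IsEmpty PEmpty)

/-- The disjoint union of two finite `G`-sets. -/
def sumObj (S T : FinGSet G) : FinGSet G := of (S.V ⊕ T.V)

/-- The cartesian product of two finite `G`-sets, with the diagonal action. -/
def prodObj (S T : FinGSet G) : FinGSet G := of (S.V × T.V)

/-- The fibre product of two maps of finite `G`-sets. -/
def pullbackObj {S T U : FinGSet G} (f : S ⟶ U) (g : T ⟶ U) : FinGSet G :=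
  letI : MulAction G {p : S.V × T.V // fn f p.1 = fn g p.2} :=
    { smul := fun a p => ⟨a • p.1, by
        rw [Prod.smul_fst, Prod.smul_snd, fn_smul, fn_smul, p.2]⟩
      one_smul := fun p => Subtype.ext (one_smul G p.1)
      mul_smul := fun a b p => Subtype.ext (mul_smul a b p.1) }
  of {p : S.V × T.V // fn f p.1 = fn g p.2}

/-- The product of two maps of finite `G`-sets. -/
def prodMap {S S' T T' : FinGSet G} (f : S ⟶ S') (g : T ⟶ T') :
    prodObj S T ⟶ prodObj S' T' :=
  homMk (S := prodObj S T) (T := prodObj S' T') (fun p => (fn f p.1, fn g p.2)) fun a p =>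
    Prod.ext (fn_smul f a p.1) (fn_smul g a p.2)

/-- The cartesian product functor on the opposite of the category of finite `G`-sets. -/
def prodOp : (FinGSet G)ᵒᵖ × (FinGSet G)ᵒᵖ ⥤ (FinGSet G)ᵒᵖ where
  obj p := Opposite.op (prodObj p.1.unop p.2.unop)
  map f := (prodMap f.1.unop f.2.unop).op
  map_id _ := rfl
  map_comp _ _ := rfl

end FinGSet

/-! ### Spans of finite `G`-sets -/

/-- Diagrams `S ← P → T` of finite `G`-sets. -/
abbrev GSpan {G : Type u} [Group G] (S T : FinGSet G) :=
  Span (⊤ : MorphismProperty (FinGSet G)) (⊤ : MorphismProperty (FinGSet G)) S T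

/-- Isomorphism classes of spans (isomorphisms are over `S` and `T`). -/
def SpanClass {G : Type u} [Group G] (S T : FinGSet G) : Type (u + 1) :=
  Quotient (isIsomorphicSetoid (GSpan S T))

namespace GSpan

open FinGSet

variable {G : Type u} [Group G] {S T U V S' T' U' : FinGSet G}

/-- The span with given legs. -/
abbrev mk {P : FinGSet G} (l : P ⟶ S) (r : P ⟶ T) : GSpan S T := ⟨P, l, r, trivial, trivial⟩

/-- The isomorphism class of a span. -/
def cls (s : GSpan S T) : SpanClass S T := Quotient.mk _ s

theorem cls_eq {s t : GSpan S T} (e : s.apex.V ≃ t.apex.V)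
    (he : ∀ (g : G) (x : s.apex.V), e (g • x) = g • e x)
    (hl : ∀ x, fn t.l (e x) = fn s.l x) (hr : ∀ x, fn t.r (e x) = fn s.r x) :
    cls s = cls t :=
  Quotient.sound ⟨Span.mkIso (isoMk e he) (FinGSet.hom_ext hl) (FinGSet.hom_ext hr)⟩

theorem exists_equiv {s t : GSpan S T} (h : IsIsomorphic s t) :
    ∃ e : s.apex.V ≃ t.apex.V, (∀ (g : G) (x : s.apex.V), e (g • x) = g • e x) ∧
      (∀ x, fn t.l (e x) = fn s.l x) ∧ (∀ x, fn t.r (e x) = fn s.r x) := by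
  obtain ⟨i⟩ := h
  let j : s.apex ≅ t.apex :=
    { hom := i.hom.hom
      inv := i.inv.hom
      hom_inv_id := congrArg Span.Hom.hom i.hom_inv_id
      inv_hom_id := congrArg Span.Hom.hom i.inv_hom_id }
  refine ⟨equivOfIso j, fun g x => fn_smul j.hom g x, fun x => ?_, fun x => ?_⟩
  · exact (fn_comp i.hom.hom t.l x).symm.trans (by rw [i.hom.hom_l])
  · exact (fn_comp i.hom.hom t.r x).symm.trans (by rw [i.hom.hom_r])

/-- The empty span. -/
def zero (S T : FinGSet G) : GSpan S T :=
  mk (P := emptyObj) (homMk (S := emptyObj) (fun x => isEmptyElim x) fun _ x => isEmptyElim x)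
    (homMk (S := emptyObj) (fun x => isEmptyElim x) fun _ x => isEmptyElim x)

/-- The disjoint union of two spans. -/
def add (s t : GSpan S T) : GSpan S T :=
  mk (P := sumObj s.apex t.apex)
    (homMk (S := sumObj s.apex t.apex) (Sum.elim (fn s.l) (fn t.l)) fun g x => by
      rcases x with x | x
      · exact fn_smul s.l g x
      · exact fn_smul t.l g x)
    (homMk (S := sumObj s.apex t.apex) (Sum.elim (fn s.r) (fn t.r)) fun g x => by
      rcases x with x | x
      · exact fn_smul s.r g x
      · exact fn_smul t.r g x)

/-- The composite of two spans, by fibre product. -/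
def comp (s : GSpan S T) (t : GSpan T U) : GSpan S U :=
  mk (P := pullbackObj s.r t.l)
    (homMk (S := pullbackObj s.r t.l) (fun p => fn s.l p.1.1) fun g p => fn_smul s.l g p.1.1)
    (homMk (S := pullbackObj s.r t.l) (fun p => fn t.r p.1.2) fun g p => fn_smul t.r g p.1.2)

/-- The cartesian product of two spans. -/
def prod (s : GSpan S T) (t : GSpan S' T') : GSpan (prodObj S S') (prodObj T T') :=
  mk (P := prodObj s.apex t.apex) (prodMap s.l t.l) (prodMap s.r t.r)

end GSpan

namespace SpanClass

open FinGSet GSpan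

variable {G : Type u} [Group G] {S T U V S' T' U' : FinGSet G}

theorem ind {p : SpanClass S T → Prop} (h : ∀ s : GSpan S T, p (cls s)) (x) : p x :=
  Quotient.inductionOn x h

/-- Disjoint union of isomorphism classes of spans. -/
def add : SpanClass S T → SpanClass S T → SpanClass S T :=
  Quotient.map₂ GSpan.add fun s s' h t t' k => by
    obtain ⟨e, he, hl, hr⟩ := exists_equiv h
    obtain ⟨f, hf, hl', hr'⟩ := exists_equiv k
    refine Quotient.exact (cls_eq (s := GSpan.add s t) (t := GSpan.add s' t')
      (Equiv.sumCongr e f) ?_ ?_ ?_)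
    · rintro g (x | x)
      · exact congrArg Sum.inl (he g x)
      · exact congrArg Sum.inr (hf g x)
    · rintro (x | x)
      · exact hl x
      · exact hl' x
    · rintro (x | x)
      · exact hr x
      · exact hr' x

instance : Add (SpanClass S T) := ⟨add⟩

instance : Zero (SpanClass S T) := ⟨cls (GSpan.zero S T)⟩

instance : AddCommMonoid (SpanClass S T) where
  add_assoc a b c := by
    induction a using ind with | _ a
    induction b using ind with | _ b
    induction c using ind with | _ c
    refine cls_eq (s := GSpan.add (GSpan.add a b) c) (t := GSpan.add a (GSpan.add b c))
      (Equiv.sumAssoc _ _ _) ?_ ?_ ?_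
    · rintro g ((x | x) | x) <;> rfl
    · rintro ((x | x) | x) <;> rfl
    · rintro ((x | x) | x) <;> rfl
  zero_add a := by
    induction a using ind with | _ a
    refine cls_eq (s := GSpan.add (GSpan.zero S T) a) (t := a)
      (Equiv.emptySum (emptyObj : FinGSet G).V a.apex.V) ?_ ?_ ?_
    · rintro g (x | x)
      · exact isEmptyElim (α := (emptyObj : FinGSet G).V) x
      · rfl
    · rintro (x | x)
      · exact isEmptyElim (α := (emptyObj : FinGSet G).V) x
      · rfl
    · rintro (x | x)
      · exact isEmptyElim (α := (emptyObj : FinGSet G).V) x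
      · rfl
  add_zero a := by
    induction a using ind with | _ a
    refine cls_eq (s := GSpan.add a (GSpan.zero S T)) (t := a)
      (Equiv.sumEmpty a.apex.V (emptyObj : FinGSet G).V) ?_ ?_ ?_
    · rintro g (x | x)
      · rfl
      · exact isEmptyElim (α := (emptyObj : FinGSet G).V) x
    · rintro (x | x)
      · rfl
      · exact isEmptyElim (α := (emptyObj : FinGSet G).V) x
    · rintro (x | x)
      · rfl
      · exact isEmptyElim (α := (emptyObj : FinGSet G).V) x
  add_comm a b := by
    induction a using ind with | _ a
    induction b using ind with | _ b
    refine cls_eq (s := GSpan.add a b) (t := GSpan.add b a) (Equiv.sumComm _ _) ?_ ?_ ?_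
    · rintro g (x | x) <;> rfl
    · rintro (x | x) <;> rfl
    · rintro (x | x) <;> rfl
  nsmul := nsmulRec

/-- Composition of isomorphism classes of spans. -/
def comp : SpanClass S T → SpanClass T U → SpanClass S U :=
  Quotient.map₂ GSpan.comp fun s s' h t t' k => by
    obtain ⟨e, he, hl, hr⟩ := exists_equiv h
    obtain ⟨f, hf, hl', hr'⟩ := exists_equiv k
    refine Quotient.exact (cls_eq (s := GSpan.comp s t) (t := GSpan.comp s' t')
      ((Equiv.prodCongr e f).subtypeEquiv fun p => ?_) ?_ ?_ ?_)
    · change fn s.r p.1 = fn t.l p.2 ↔ fn s'.r (e p.1) = fn t'.l (f p.2)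
      rw [hr, hl']
    · exact fun g p => Subtype.ext (Prod.ext (he g p.1.1) (hf g p.1.2))
    · exact fun p => hl p.1.1
    · exact fun p => hr' p.1.2

/-- The class of the identity span. -/
def id (S : FinGSet G) : SpanClass S S := cls (GSpan.mk (𝟙 S) (𝟙 S))

/-- Cartesian product of isomorphism classes of spans. -/
def prod : SpanClass S T → SpanClass S' T' → SpanClass (prodObj S S') (prodObj T T') :=
  Quotient.map₂ GSpan.prod fun s s' h t t' k => by
    obtain ⟨e, he, hl, hr⟩ := exists_equiv h
    obtain ⟨f, hf, hl', hr'⟩ := exists_equiv k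
    refine Quotient.exact (cls_eq (s := GSpan.prod s t) (t := GSpan.prod s' t')
      (Equiv.prodCongr e f) ?_ ?_ ?_)
    · exact fun g p => Prod.ext (he g p.1) (hf g p.2)
    · exact fun p => Prod.ext (hl p.1) (hl' p.2)
    · exact fun p => Prod.ext (hr p.1) (hr' p.2)

theorem id_comp (a : SpanClass S T) : comp (id S) a = a := by
  induction a using ind with | _ a
  refine cls_eq (s := GSpan.comp (GSpan.mk (𝟙 S) (𝟙 S)) a) (t := a)
    { toFun := fun p => p.1.2
      invFun := fun x => ⟨(fn a.l x, x), rfl⟩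
      left_inv := fun p => Subtype.ext (Prod.ext p.2.symm rfl)
      right_inv := fun _ => rfl } (fun _ _ => rfl) (fun p => p.2.symm) (fun _ => rfl)

theorem comp_id (a : SpanClass S T) : comp a (id T) = a := by
  induction a using ind with | _ a
  refine cls_eq (s := GSpan.comp a (GSpan.mk (𝟙 T) (𝟙 T))) (t := a)
    { toFun := fun p => p.1.1
      invFun := fun x => ⟨(x, fn a.r x), rfl⟩
      left_inv := fun p => Subtype.ext (Prod.ext rfl p.2)
      right_inv := fun _ => rfl } (fun _ _ => rfl) (fun _ => rfl) (fun p => p.2)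

theorem assoc (a : SpanClass S T) (b : SpanClass T U) (c : SpanClass U V) :
    comp (comp a b) c = comp a (comp b c) := by
  induction a using ind with | _ a
  induction b using ind with | _ b
  induction c using ind with | _ c
  exact cls_eq (s := GSpan.comp (GSpan.comp a b) c) (t := GSpan.comp a (GSpan.comp b c))
    { toFun := fun p => ⟨(p.1.1.1.1, ⟨(p.1.1.1.2, p.1.2), p.2⟩), p.1.1.2⟩
      invFun := fun p => ⟨(⟨(p.1.1, p.1.2.1.1), p.2⟩, p.1.2.1.2), p.1.2.2⟩
      left_inv := fun _ => rfl
      right_inv := fun _ => rfl } (fun _ _ => rfl) (fun _ => rfl) (fun _ => rfl)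

theorem zero_comp (b : SpanClass T U) : comp (0 : SpanClass S T) b = 0 := by
  induction b using ind with | _ b
  have : IsEmpty (GSpan.comp (GSpan.zero S T) b).apex.V :=
    ⟨fun p => isEmptyElim (α := (emptyObj : FinGSet G).V) p.1.1⟩
  have : IsEmpty (GSpan.zero S U).apex.V := inferInstanceAs (IsEmpty (emptyObj : FinGSet G).V)
  exact cls_eq (s := GSpan.comp (GSpan.zero S T) b) (t := GSpan.zero S U) (Equiv.equivOfIsEmpty _ _)
    (fun _ p => isEmptyElim p) (fun p => isEmptyElim p) (fun p => isEmptyElim p)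

theorem comp_zero (a : SpanClass S T) : comp a (0 : SpanClass T U) = 0 := by
  induction a using ind with | _ a
  have : IsEmpty (GSpan.comp a (GSpan.zero T U)).apex.V :=
    ⟨fun p => isEmptyElim (α := (emptyObj : FinGSet G).V) p.1.2⟩
  have : IsEmpty (GSpan.zero S U).apex.V := inferInstanceAs (IsEmpty (emptyObj : FinGSet G).V)
  exact cls_eq (s := GSpan.comp a (GSpan.zero T U)) (t := GSpan.zero S U) (Equiv.equivOfIsEmpty _ _)
    (fun _ p => isEmptyElim p) (fun p => isEmptyElim p) (fun p => isEmptyElim p)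

theorem add_comp (a a' : SpanClass S T) (b : SpanClass T U) :
    comp (a + a') b = comp a b + comp a' b := by
  induction a using ind with | _ a
  induction a' using ind with | _ a'
  induction b using ind with | _ b
  refine cls_eq (s := GSpan.comp (GSpan.add a a') b)
    (t := GSpan.add (GSpan.comp a b) (GSpan.comp a' b))
    { toFun := fun p => match p with
        | ⟨(Sum.inl x, y), h⟩ => Sum.inl ⟨(x, y), h⟩
        | ⟨(Sum.inr x, y), h⟩ => Sum.inr ⟨(x, y), h⟩
      invFun := Sum.elim (fun p => ⟨(Sum.inl p.1.1, p.1.2), p.2⟩)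
        (fun p => ⟨(Sum.inr p.1.1, p.1.2), p.2⟩)
      left_inv := ?_
      right_inv := ?_ } ?_ ?_ ?_
  · rintro ⟨⟨x | x, y⟩, h⟩ <;> rfl
  · rintro (p | p) <;> rfl
  · rintro g ⟨⟨x | x, y⟩, h⟩ <;> rfl
  · rintro ⟨⟨x | x, y⟩, h⟩ <;> rfl
  · rintro ⟨⟨x | x, y⟩, h⟩ <;> rfl

theorem comp_add (a : SpanClass S T) (b b' : SpanClass T U) :
    comp a (b + b') = comp a b + comp a b' := by
  induction a using ind with | _ a
  induction b using ind with | _ b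
  induction b' using ind with | _ b'
  refine cls_eq (s := GSpan.comp a (GSpan.add b b'))
    (t := GSpan.add (GSpan.comp a b) (GSpan.comp a b'))
    { toFun := fun p => match p with
        | ⟨(x, Sum.inl y), h⟩ => Sum.inl ⟨(x, y), h⟩
        | ⟨(x, Sum.inr y), h⟩ => Sum.inr ⟨(x, y), h⟩
      invFun := Sum.elim (fun p => ⟨(p.1.1, Sum.inl p.1.2), p.2⟩)
        (fun p => ⟨(p.1.1, Sum.inr p.1.2), p.2⟩)
      left_inv := ?_
      right_inv := ?_ } ?_ ?_ ?_
  · rintro ⟨⟨x, y | y⟩, h⟩ <;> rfl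
  · rintro (p | p) <;> rfl
  · rintro g ⟨⟨x, y | y⟩, h⟩ <;> rfl
  · rintro ⟨⟨x, y | y⟩, h⟩ <;> rfl
  · rintro ⟨⟨x, y | y⟩, h⟩ <;> rfl

theorem zero_prod (b : SpanClass S' T') : prod (0 : SpanClass S T) b = 0 := by
  induction b using ind with | _ b
  have : IsEmpty (GSpan.prod (GSpan.zero S T) b).apex.V :=
    ⟨fun p => isEmptyElim (α := (emptyObj : FinGSet G).V) p.1⟩
  have : IsEmpty (GSpan.zero (prodObj S S') (prodObj T T')).apex.V :=
    inferInstanceAs (IsEmpty (emptyObj : FinGSet G).V)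
  exact cls_eq (s := GSpan.prod (GSpan.zero S T) b) (t := GSpan.zero _ _)
    (Equiv.equivOfIsEmpty _ _)
    (fun _ p => isEmptyElim p) (fun p => isEmptyElim p) (fun p => isEmptyElim p)

theorem prod_zero (a : SpanClass S T) : prod a (0 : SpanClass S' T') = 0 := by
  induction a using ind with | _ a
  have : IsEmpty (GSpan.prod a (GSpan.zero S' T')).apex.V :=
    ⟨fun p => isEmptyElim (α := (emptyObj : FinGSet G).V) p.2⟩
  have : IsEmpty (GSpan.zero (prodObj S S') (prodObj T T')).apex.V :=
    inferInstanceAs (IsEmpty (emptyObj : FinGSet G).V)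
  exact cls_eq (s := GSpan.prod a (GSpan.zero S' T')) (t := GSpan.zero _ _)
    (Equiv.equivOfIsEmpty _ _)
    (fun _ p => isEmptyElim p) (fun p => isEmptyElim p) (fun p => isEmptyElim p)

theorem add_prod (a a' : SpanClass S T) (b : SpanClass S' T') :
    prod (a + a') b = prod a b + prod a' b := by
  induction a using ind with | _ a
  induction a' using ind with | _ a'
  induction b using ind with | _ b
  refine cls_eq (s := GSpan.prod (GSpan.add a a') b)
    (t := GSpan.add (GSpan.prod a b) (GSpan.prod a' b)) (Equiv.sumProdDistrib _ _ _) ?_ ?_ ?_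
  · rintro g ⟨x | x, y⟩ <;> rfl
  · rintro ⟨x | x, y⟩ <;> rfl
  · rintro ⟨x | x, y⟩ <;> rfl

theorem prod_add (a : SpanClass S T) (b b' : SpanClass S' T') :
    prod a (b + b') = prod a b + prod a b' := by
  induction a using ind with | _ a
  induction b using ind with | _ b
  induction b' using ind with | _ b'
  refine cls_eq (s := GSpan.prod a (GSpan.add b b'))
    (t := GSpan.add (GSpan.prod a b) (GSpan.prod a b')) (Equiv.prodSumDistrib _ _ _) ?_ ?_ ?_
  · rintro g ⟨x, y | y⟩ <;> rfl
  · rintro ⟨x, y | y⟩ <;> rfl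
  · rintro ⟨x, y | y⟩ <;> rfl

theorem prod_id (S T : FinGSet G) : prod (id S) (id T) = id (prodObj S T) := rfl

theorem prod_comp (a : SpanClass S T) (b : SpanClass T U) (a' : SpanClass S' T')
    (b' : SpanClass T' U') :
    prod (comp a b) (comp a' b') = comp (prod a a') (prod b b') := by
  induction a using ind with | _ a
  induction b using ind with | _ b
  induction a' using ind with | _ a'
  induction b' using ind with | _ b'
  exact cls_eq (s := GSpan.prod (GSpan.comp a b) (GSpan.comp a' b'))
    (t := GSpan.comp (GSpan.prod a a') (GSpan.prod b b'))
    { toFun := fun p => ⟨((p.1.1.1, p.2.1.1), (p.1.1.2, p.2.1.2)), Prod.ext p.1.2 p.2.2⟩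
      invFun := fun p => (⟨(p.1.1.1, p.1.2.1), congrArg Prod.fst p.2⟩,
        ⟨(p.1.1.2, p.1.2.2), congrArg Prod.snd p.2⟩)
      left_inv := fun _ => rfl
      right_inv := fun _ => rfl } (fun _ _ => rfl) (fun _ => rfl) (fun _ => rfl)

end SpanClass

/-! ### The Burnside category -/

/-- Objects of the Burnside category of `G`: the finite `G`-sets. -/
structure BurnsideCat (G : Type u) [Group G] where
  /-- The underlying finite `G`-set. -/
  set : FinGSet G

/-- The group completion of the monoid of isomorphism classes of spans under disjoint union. -/
abbrev BurnsideHom {G : Type u} [Group G] (S T : FinGSet G) : Type (u + 1) :=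
  Algebra.GrothendieckAddGroup (SpanClass S T)

namespace BurnsideHom

open FinGSet Algebra

variable {G : Type u} [Group G] {S T U V S' T' U' : FinGSet G}

/-- The morphism given by a class of spans. -/
def of : SpanClass S T →+ BurnsideHom S T := GrothendieckAddGroup.of

theorem ind {p : BurnsideHom S T → Prop} (h : ∀ a b : SpanClass S T, p (of a - of b))
    (x : BurnsideHom S T) : p x := by
  induction x using AddLocalization.ind with | _ y
  have := h y.1 y.2.1
  have h1 (a : SpanClass S T) : of a = AddLocalization.mk a 0 :=
    (AddLocalization.mk_zero_eq_addMonoidOf_mk (S := ⊤) a).symm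
  rw [h1, h1, GrothendieckAddGroup.mk_sub_mk] at this
  convert this using 2
  · exact (add_zero _).symm
  · exact Subtype.ext (zero_add _).symm

/-- The additive extension of a map on classes of spans. -/
noncomputable def lift {A : Type*} [AddCommGroup A] (f : SpanClass S T →+ A) :
    BurnsideHom S T →+ A :=
  GrothendieckAddGroup.lift f

@[simp] theorem lift_of {A : Type*} [AddCommGroup A] (f : SpanClass S T →+ A)
    (a : SpanClass S T) : lift f (of a) = f a :=
  DFunLike.congr_fun (GrothendieckAddGroup.lift.symm_apply_apply f) a

theorem hom_ext {A : Type*} [AddCommGroup A] {f g : BurnsideHom S T →+ A}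
    (h : ∀ a, f (of a) = g (of a)) : f = g :=
  GrothendieckAddGroup.lift.symm.injective (AddMonoidHom.ext h)

/-- Composition, the biadditive extension of composition of spans. -/
noncomputable def comp : BurnsideHom S T →+ BurnsideHom T U →+ BurnsideHom S U :=
  lift
    { toFun := fun a => lift
        { toFun := fun b => of (SpanClass.comp a b)
          map_zero' := by rw [SpanClass.comp_zero, map_zero]
          map_add' := fun b b' => by rw [SpanClass.comp_add, map_add] }
      map_zero' := hom_ext fun b => by
        rw [lift_of]
        exact (congrArg of (SpanClass.zero_comp b)).trans (map_zero of)
      map_add' := fun a a' => hom_ext fun b => by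
        rw [AddMonoidHom.add_apply, lift_of, lift_of, lift_of]
        exact (congrArg of (SpanClass.add_comp a a' b)).trans (map_add of _ _) }

/-- Cartesian product, the biadditive extension of the cartesian product of spans. -/
noncomputable def prod :
    BurnsideHom S T →+ BurnsideHom S' T' →+ BurnsideHom (prodObj S S') (prodObj T T') :=
  lift
    { toFun := fun a => lift
        { toFun := fun b => of (SpanClass.prod a b)
          map_zero' := by rw [SpanClass.prod_zero, map_zero]
          map_add' := fun b b' => by rw [SpanClass.prod_add, map_add] }
      map_zero' := hom_ext fun b => by
        rw [lift_of]
        exact (congrArg of (SpanClass.zero_prod b)).trans (map_zero of)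
      map_add' := fun a a' => hom_ext fun b => by
        rw [AddMonoidHom.add_apply, lift_of, lift_of, lift_of]
        exact (congrArg of (SpanClass.add_prod a a' b)).trans (map_add of _ _) }

@[simp] theorem comp_of (a : SpanClass S T) (b : SpanClass T U) :
    comp (of a) (of b) = of (SpanClass.comp a b) := by
  rw [comp, lift_of]
  exact lift_of _ b

@[simp] theorem prod_of (a : SpanClass S T) (b : SpanClass S' T') :
    prod (of a) (of b) = of (SpanClass.prod a b) := by
  rw [prod, lift_of]
  exact lift_of _ b

theorem id_comp (f : BurnsideHom S T) : comp (of (SpanClass.id S)) f = f := by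
  induction f using ind with | _ a b
  rw [map_sub, comp_of, comp_of, SpanClass.id_comp, SpanClass.id_comp]

theorem comp_id (f : BurnsideHom S T) : comp f (of (SpanClass.id T)) = f := by
  induction f using ind with | _ a b
  rw [map_sub, AddMonoidHom.sub_apply, comp_of, comp_of, SpanClass.comp_id, SpanClass.comp_id]

theorem assoc (f : BurnsideHom S T) (g : BurnsideHom T U) (h : BurnsideHom U V) :
    comp (comp f g) h = comp f (comp g h) := by
  induction f using ind with | _ a a'
  induction g using ind with | _ b b'
  induction h using ind with | _ c c'
  simp only [map_sub, AddMonoidHom.sub_apply, comp_of, SpanClass.assoc]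

theorem add_comp (f f' : BurnsideHom S T) (g : BurnsideHom T U) :
    comp (f + f') g = comp f g + comp f' g := by
  rw [map_add, AddMonoidHom.add_apply]

theorem comp_add (f : BurnsideHom S T) (g g' : BurnsideHom T U) :
    comp f (g + g') = comp f g + comp f g' := by
  rw [map_add]

theorem prod_comp (f : BurnsideHom S T) (g : BurnsideHom T U) (f' : BurnsideHom S' T')
    (g' : BurnsideHom T' U') :
    prod (comp f g) (comp f' g') = comp (prod f f') (prod g g') := by
  induction f using ind with | _ a b
  induction g using ind with | _ c d
  induction f' using ind with | _ a' b'
  induction g' using ind with | _ c' d'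
  simp only [map_sub, AddMonoidHom.sub_apply, comp_of, prod_of, SpanClass.prod_comp]
  abel

end BurnsideHom

namespace BurnsideCat

open FinGSet

variable {G : Type u} [Group G]

noncomputable instance : Category (BurnsideCat G) where
  Hom S T := BurnsideHom S.set T.set
  id S := BurnsideHom.of (SpanClass.id S.set)
  comp f g := BurnsideHom.comp f g
  id_comp := BurnsideHom.id_comp
  comp_id := BurnsideHom.comp_id
  assoc := BurnsideHom.assoc

noncomputable instance (S T : BurnsideCat G) : AddCommGroup (S ⟶ T) :=
  inferInstanceAs (AddCommGroup (BurnsideHom S.set T.set))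

attribute [local irreducible] BurnsideHom.comp in
noncomputable instance : Preadditive (BurnsideCat G) where
  add_comp S T U f f' g :=
    BurnsideHom.add_comp (S := S.set) (T := T.set) (U := U.set) f f' g
  comp_add S T U f g g' :=
    BurnsideHom.comp_add (S := S.set) (T := T.set) (U := U.set) f g g'

/-- The cartesian product on the Burnside category. -/
noncomputable def prod : BurnsideCat G × BurnsideCat G ⥤ BurnsideCat G where
  obj p := ⟨prodObj p.1.set p.2.set⟩
  map f := BurnsideHom.prod f.1 f.2
  map_id _ := BurnsideHom.prod_of _ _
  map_comp f g := BurnsideHom.prod_comp f.1 g.1 f.2 g.2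

/-- The contravariant inclusion of finite `G`-sets: the map `f : S ⟶ T` goes to the span
`T ← S = S`, a morphism from `T` to `S`. -/
noncomputable def ofOp : (FinGSet G)ᵒᵖ ⥤ BurnsideCat G where
  obj S := ⟨S.unop⟩
  map {S T} f := BurnsideHom.of (GSpan.cls (GSpan.mk f.unop (𝟙 T.unop)))
  map_id _ := rfl
  map_comp {S T U} f g := by
    refine Eq.trans ?_ (BurnsideHom.comp_of _ _).symm
    refine congrArg BurnsideHom.of ?_
    exact GSpan.cls_eq (s := GSpan.mk (f ≫ g).unop (𝟙 U.unop))
      (t := GSpan.comp (GSpan.mk f.unop (𝟙 T.unop)) (GSpan.mk g.unop (𝟙 U.unop)))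
      { toFun := fun x => ⟨(fn g.unop x, x), rfl⟩
        invFun := fun p => p.1.2
        left_inv := fun _ => rfl
        right_inv := fun p => Subtype.ext (Prod.ext p.2.symm rfl) }
      (fun a x => Subtype.ext (Prod.ext (fn_smul g.unop a x) rfl)) (fun _ => rfl) (fun _ => rfl)

end BurnsideCat

/-! ### Smallness -/

section Smallness

variable (G : Type u) [Group G] [Finite G]

instance : Countable (Skeleton (FinGSet G)) := by
  let F : (Σ n : ℕ, G →* Equiv.Perm (Fin n)) → Skeleton (FinGSet G) := fun p =>
    letI : MulAction G (ULift.{u} (Fin p.1)) :=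
      { smul := fun g x => ⟨p.2 g x.down⟩
        one_smul := fun x => ULift.ext _ _ (by
          change p.2 1 x.down = x.down
          rw [map_one]; rfl)
        mul_smul := fun g h x => ULift.ext _ _ (by
          change p.2 (g * h) x.down = p.2 g (p.2 h x.down)
          rw [map_mul]; rfl) }
    toSkeleton (FinGSet.of (G := G) (ULift.{u} (Fin p.1)))
  have : ∀ n, Finite (G →* Equiv.Perm (Fin n)) := fun n =>
    Finite.of_injective (fun f : G →* Equiv.Perm (Fin n) => (f : G → Equiv.Perm (Fin n)))
      DFunLike.coe_injective
  refine Function.Surjective.countable (f := F) fun X => ?_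
  obtain ⟨S, rfl⟩ := Quotient.exists_rep X
  obtain ⟨n, ⟨e⟩⟩ := Finite.exists_equiv_fin S.V
  refine ⟨⟨n, e.permCongrHom.toMonoidHom.comp (MulAction.toPermHom G S.V)⟩, Quotient.sound ⟨?_⟩⟩
  refine (FinGSet.isoMk (e.trans Equiv.ulift.symm) fun g x => ?_).symm
  refine ULift.ext _ _ ?_
  change e (g • x) = e (g • e.symm (e x))
  rw [Equiv.symm_apply_apply]

instance (S T : FinGSet G) : Finite (S ⟶ T) :=
  Finite.of_injective (FinGSet.fn (S := S) (T := T)) fun _ _ h => FinGSet.hom_ext (congrFun h)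

instance : LocallySmall.{w} (FinGSet G) := ⟨fun _ _ => inferInstance⟩

instance : EssentiallySmall.{w} (FinGSet G) :=
  (essentiallySmall_iff _).2 ⟨inferInstance, inferInstance⟩

instance (S T : FinGSet G) : Countable (SpanClass S T) := by
  let F : (Σ X : Skeleton (FinGSet G), ((fromSkeleton _).obj X ⟶ S) × ((fromSkeleton _).obj X ⟶ T)) → SpanClass S T := fun p =>
    GSpan.cls (GSpan.mk p.2.1 p.2.2)
  refine Function.Surjective.countable (f := F) fun a => ?_
  induction a using SpanClass.ind with | _ s
  let i : (fromSkeleton _).obj (toSkeleton s.apex) ≅ s.apex := fromSkeletonToSkeletonIso s.apex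
  refine ⟨⟨toSkeleton s.apex, i.hom ≫ s.l, i.hom ≫ s.r⟩, ?_⟩
  exact GSpan.cls_eq (FinGSet.equivOfIso i) (fun g x => FinGSet.fn_smul i.hom g x)
    (fun _ => rfl) (fun _ => rfl)

instance (S T : BurnsideCat G) : Countable (S ⟶ T) := by
  refine Function.Surjective.countable
    (f := fun p : SpanClass S.set T.set × SpanClass S.set T.set =>
      (BurnsideHom.of p.1 - BurnsideHom.of p.2 : BurnsideHom S.set T.set)) fun x => ?_
  induction x using BurnsideHom.ind with | _ a b
  exact ⟨(a, b), rfl⟩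

instance : LocallySmall.{w} (BurnsideCat G) := ⟨fun _ _ => inferInstance⟩

instance : Countable (Skeleton (BurnsideCat G)) := by
  refine Function.Surjective.countable
    (f := fun X : Skeleton (FinGSet G) => toSkeleton (BurnsideCat.mk ((fromSkeleton _).obj X))) fun X => ?_
  obtain ⟨S, rfl⟩ := Quotient.exists_rep X
  let i : (fromSkeleton _).obj (toSkeleton S.set) ≅ S.set := fromSkeletonToSkeletonIso S.set
  exact ⟨toSkeleton S.set, Quotient.sound ⟨BurnsideCat.ofOp.mapIso i.symm.op⟩⟩

instance : EssentiallySmall.{w} (BurnsideCat G) :=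
  (essentiallySmall_iff _).2 ⟨inferInstance, inferInstance⟩

end Smallness

/-- A product of essentially small categories is essentially small. -/
instance {C : Type*} {D : Type*} [Category* C] [Category* D] [EssentiallySmall.{w} C]
    [EssentiallySmall.{w} D] : EssentiallySmall.{w} (C × D) :=
  ⟨SmallModel.{w} C × SmallModel.{w} D, inferInstance,
    ⟨(equivSmallModel.{w} C).prod (equivSmallModel.{w} D)⟩⟩

/-! ### Additive left Kan extensions -/

section AdditiveKan

variable {C : Type*} [Category* C] {D : Type*} [Category* D] [Preadditive D]

/-- The subgroup of `F(X)` generated by the elements `F(f + g)(x) - F(f)(x) - F(g)(x)`. -/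
def nonadditivity (F : D ⥤ AddCommGrpCat.{w}) (X : D) : AddSubgroup (F.obj X) :=
  AddSubgroup.closure {z | ∃ (Y : D) (f g : Y ⟶ X) (x : F.obj Y),
    z = F.map (f + g) x - F.map f x - F.map g x}

theorem nonadditivity_map (F : D ⥤ AddCommGrpCat.{w}) {X X' : D} (h : X ⟶ X') :
    nonadditivity F X ≤ (nonadditivity F X').comap (F.map h).hom := by
  refine (AddSubgroup.closure_le _).2 ?_
  rintro _ ⟨Y, f, g, x, rfl⟩
  refine AddSubgroup.subset_closure ⟨Y, f ≫ h, g ≫ h, x, ?_⟩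
  change F.map h (F.map (f + g) x - F.map f x - F.map g x) = _
  rw [map_sub, map_sub, ← Preadditive.add_comp]
  simp only [Functor.map_comp, ConcreteCategory.comp_apply]

/-- The largest additive quotient of a functor. -/
def additiveQuotient (F : D ⥤ AddCommGrpCat.{w}) : D ⥤ AddCommGrpCat.{w} where
  obj X := AddCommGrpCat.of (F.obj X ⧸ nonadditivity F X)
  map h := AddCommGrpCat.ofHom (QuotientAddGroup.map _ _ (F.map h).hom (nonadditivity_map F h))
  map_id X := by
    ext x
    simp
  map_comp f g := by
    ext x
    simp

instance (F : D ⥤ AddCommGrpCat.{w}) : (additiveQuotient F).Additive where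
  map_add {Y X f g} := by
    ext x
    induction x using QuotientAddGroup.induction_on with | _ x
    change (QuotientAddGroup.mk (F.map (f + g) x) : F.obj X ⧸ nonadditivity F X) =
      QuotientAddGroup.mk (F.map f x) + QuotientAddGroup.mk (F.map g x)
    rw [← QuotientAddGroup.mk_add, ← sub_eq_zero, ← QuotientAddGroup.mk_sub,
      QuotientAddGroup.eq_zero_iff, ← sub_sub]
    exact AddSubgroup.subset_closure ⟨Y, f, g, x, rfl⟩

/-- The projection of a functor to its largest additive quotient. -/
def additiveQuotientMk (F : D ⥤ AddCommGrpCat.{w}) : F ⟶ additiveQuotient F where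
  app X := AddCommGrpCat.ofHom (QuotientAddGroup.mk' (nonadditivity F X))
  naturality _ _ _ := rfl

theorem nonadditivity_le_ker {F P : D ⥤ AddCommGrpCat.{w}} [P.Additive] (φ : F ⟶ P) (X : D) :
    nonadditivity F X ≤ (φ.app X).hom.ker := by
  refine (AddSubgroup.closure_le _).2 ?_
  rintro _ ⟨Y, f, g, x, rfl⟩
  have h {Z : D} (k : Y ⟶ Z) (x) : φ.app Z (F.map k x) = P.map k (φ.app Y x) :=
    ConcreteCategory.congr_hom (φ.naturality k) x
  change φ.app X (F.map (f + g) x - F.map f x - F.map g x) = 0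
  rw [map_sub, map_sub, h, h, h, P.map_add, sub_sub, sub_eq_zero]
  rfl

/-- A natural transformation to an additive functor factors through the additive quotient. -/
def additiveQuotientDesc {F P : D ⥤ AddCommGrpCat.{w}} [P.Additive] (φ : F ⟶ P) :
    additiveQuotient F ⟶ P where
  app X := AddCommGrpCat.ofHom
    (QuotientAddGroup.lift _ (φ.app X).hom (nonadditivity_le_ker φ X))
  naturality X Y f := by
    ext x
    induction x using QuotientAddGroup.induction_on with | _ x
    exact ConcreteCategory.congr_hom (φ.naturality f) x

/-- Additive functors form a reflective subcategory of all functors. -/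
instance : (AdditiveFunctor.forget D AddCommGrpCat.{w}).IsRightAdjoint :=
  (Adjunction.adjunctionOfEquivLeft (G := AdditiveFunctor.forget D AddCommGrpCat.{w})
    (F_obj := fun F => AdditiveFunctor.of (additiveQuotient F))
    (e := fun F P =>
      { toFun := fun φ => additiveQuotientMk F ≫ φ.hom
        invFun := fun φ => ⟨additiveQuotientDesc (P := P.obj) φ⟩
        left_inv := fun φ => by
          ext X x
          induction x using QuotientAddGroup.induction_on
          rfl
        right_inv := fun φ => by
          ext X x
          rfl })
    (he := fun _ _ _ _ _ => rfl)).isRightAdjoint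

/-- Restriction of additive functors on `D` along a functor `K : C ⥤ D`. -/
abbrev additiveRestriction (K : C ⥤ D) :
    (D ⥤+ AddCommGrpCat.{w}) ⥤ (C ⥤ AddCommGrpCat.{w}) :=
  AdditiveFunctor.forget D AddCommGrpCat.{w} ⋙
    (Functor.whiskeringLeft C D AddCommGrpCat.{w}).obj K

/-- Ordinary left Kan extensions of abelian group valued functors exist. -/
instance hasLeftKanExtension_of_essentiallySmall {C : Type*} [Category* C] {D : Type*}
    [Category* D] [EssentiallySmall.{w} C] [LocallySmall.{w} D] (K : C ⥤ D)
    (F : C ⥤ AddCommGrpCat.{w}) : K.HasLeftKanExtension F :=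
  have (Y : D) : HasColimitsOfShape (CostructuredArrow K Y) AddCommGrpCat.{w} :=
    hasColimitsOfShape_of_essentiallySmall.{w} _ _
  inferInstance

instance [EssentiallySmall.{w} C] [LocallySmall.{w} D] (K : C ⥤ D) :
    (additiveRestriction.{w} K).IsRightAdjoint :=
  have := (K.lanAdjunction AddCommGrpCat.{w}).isRightAdjoint
  inferInstance

/-- The left Kan extension along `K : C ⥤ D` with values in additive functors on `D`, i.e. the
left adjoint of restriction along `K` of additive functors. -/
noncomputable def additiveLan [EssentiallySmall.{w} C] [LocallySmall.{w} D] (K : C ⥤ D) :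
    (C ⥤ AddCommGrpCat.{w}) ⥤ (D ⥤+ AddCommGrpCat.{w}) :=
  (additiveRestriction.{w} K).leftAdjoint

/-- The defining universal property of `additiveLan`. -/
noncomputable def additiveLanAdjunction [EssentiallySmall.{w} C] [LocallySmall.{w} D]
    (K : C ⥤ D) : additiveLan.{w} K ⊣ additiveRestriction K :=
  Adjunction.ofIsRightAdjoint _

end AdditiveKan

/-! ### Tensor products of abelian group valued functors -/

/-- The tensor product of abelian groups. -/
noncomputable def abTensor :
    AddCommGrpCat.{w} × AddCommGrpCat.{w} ⥤ AddCommGrpCat.{w} where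
  obj p := AddCommGrpCat.of (p.1 ⊗[ℤ] p.2)
  map f := AddCommGrpCat.ofHom
    (TensorProduct.map f.1.hom.toIntLinearMap f.2.hom.toIntLinearMap).toAddMonoidHom
  map_id p := by
    ext x
    exact DFunLike.congr_fun TensorProduct.map_id x
  map_comp {p q r} f g := by
    ext x
    exact DFunLike.congr_fun (TensorProduct.map_comp g.1.hom.toIntLinearMap
      g.2.hom.toIntLinearMap f.1.hom.toIntLinearMap f.2.hom.toIntLinearMap) x

/-- The external tensor product, `(F, H) ↦ ((c, d) ↦ F(c) ⊗ H(d))`. -/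
noncomputable def externalTensor (C : Type*) [Category* C] (D : Type*) [Category* D] :
    (C ⥤ AddCommGrpCat.{w}) × (D ⥤ AddCommGrpCat.{w}) ⥤ (C × D ⥤ AddCommGrpCat.{w}) :=
  prodFunctor ⋙ (Functor.whiskeringRight _ _ _).obj abTensor

/-! ### Coefficient systems -/

/-- A finite `G`-set is an orbit if it is nonempty and transitive, i.e. isomorphic to some
`G/H`. -/
def isOrbit (G : Type u) [Group G] : ObjectProperty (FinGSet G) := fun S =>
  Nonempty S.V ∧ MulAction.IsPretransitive G S.V

/-- The orbit category of `G`. -/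
abbrev OrbitCat (G : Type u) [Group G] := (isOrbit G).FullSubcategory

instance (G : Type u) [Group G] [Finite G] : EssentiallySmall.{w} (OrbitCat G) :=
  essentiallySmall_of_fully_faithful (isOrbit G).ι

/-- Coefficient systems: functors from the opposite of the orbit category to abelian groups. -/
abbrev CoeffSys (G : Type u) [Group G] := (OrbitCat G)ᵒᵖ ⥤ AddCommGrpCat.{w}

/-- Mackey functors: additive functors from the Burnside category to abelian groups. -/
abbrev Mackey (G : Type u) [Group G] := BurnsideCat G ⥤+ AddCommGrpCat.{w}

namespace CoeffSys

open FinGSet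

variable {G : Type u} [Group G]

/-- The set of orbits of a finite `G`-set. -/
abbrev Orbits (S : FinGSet G) := MulAction.orbitRel.Quotient G S.V

/-- An orbit `ω` of `S`, as an object of the orbit category. -/
def orbit {S : FinGSet G} (ω : Orbits S) : OrbitCat G where
  obj := of (MulAction.orbitRel.Quotient.orbit ω)
  property := ⟨(MulAction.orbitRel.Quotient.nonempty_orbit ω).to_subtype,
    inferInstanceAs (MulAction.IsPretransitive G (MulAction.orbitRel.Quotient.orbit ω))⟩

/-- The map on sets of orbits induced by a map of finite `G`-sets. -/
def orbitsMap {S T : FinGSet G} (f : S ⟶ T) : Orbits S → Orbits T :=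
  Quotient.map (fn f) fun x y h => by
    obtain ⟨g, hg⟩ := h
    exact ⟨g, by rw [← hg]; exact (fn_smul f g y).symm⟩

/-- The restriction `ω ⟶ f(ω)` of a map of finite `G`-sets to an orbit. -/
def orbitMap {S T : FinGSet G} (f : S ⟶ T) (ω : Orbits S) : orbit ω ⟶ orbit (orbitsMap f ω) :=
  ⟨homMk (S := (orbit ω).obj) (T := (orbit (orbitsMap f ω)).obj)
    (fun x => ⟨fn f x.1, MulAction.orbitRel.Quotient.mem_orbit.2
      (congrArg (orbitsMap f) (MulAction.orbitRel.Quotient.mem_orbit.1 x.2))⟩)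
    fun g x => Subtype.ext (fn_smul f g x.1)⟩

/-- The value at `S` of the extension of a coefficient system: the direct sum of the values at the
orbits of `S`. -/
noncomputable abbrev extendObj (A : CoeffSys.{w} G) (S : FinGSet G) : AddCommGrpCat.{w} :=
  ⨁ fun ω : Orbits S => A.obj (Opposite.op (orbit ω))

/-- The map induced by `f : S ⟶ T` sends the component of `f(ω)` to the component of `ω`. -/
noncomputable abbrev extendMap (A : CoeffSys.{w} G) {S T : FinGSet G} (f : S ⟶ T) :
    extendObj A T ⟶ extendObj A S :=
  biproduct.lift fun ω => biproduct.π _ (orbitsMap f ω) ≫ A.map (orbitMap f ω).op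

theorem π_comp_map_eq (A : CoeffSys.{w} G) {T : FinGSet G} {X : OrbitCat G} {ω ω' : Orbits T}
    (h : ω = ω') (f : X ⟶ orbit ω) (f' : X ⟶ orbit ω')
    (hf : ∀ x : X.obj.V, (fn f.hom x : ω.orbit).1 = (fn f'.hom x : ω'.orbit).1) :
    biproduct.π (fun ω : Orbits T => A.obj (Opposite.op (orbit ω))) ω ≫ A.map f.op =
      biproduct.π _ ω' ≫ A.map f'.op := by
  subst h
  obtain rfl : f = f' := by
    apply ObjectProperty.hom_ext
    exact FinGSet.hom_ext fun x => Subtype.ext (hf x)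
  rfl

/-- The extension of coefficient systems to all finite `G`-sets by
`A(∐ᵢ ωᵢ) = ⨁ᵢ A(ωᵢ)`. -/
noncomputable def extend (G : Type u) [Group G] :
    CoeffSys.{w} G ⥤ ((FinGSet G)ᵒᵖ ⥤ AddCommGrpCat.{w}) where
  obj A :=
    { obj := fun S => extendObj A S.unop
      map := fun f => extendMap A f.unop
      map_id := fun S => by
        refine biproduct.hom_ext _ _ fun ω => ?_
        rw [biproduct.lift_π, Category.id_comp]
        refine Eq.trans (π_comp_map_eq A (ω' := ω) ?_ _ (𝟙 _) fun x => rfl) ?_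
        · induction ω using Quotient.inductionOn
          rfl
        · rw [op_id, A.map_id, Category.comp_id]
      map_comp := fun {S T U} f g => by
        refine biproduct.hom_ext _ _ fun ω => ?_
        rw [biproduct.lift_π, Category.assoc, biproduct.lift_π, biproduct.lift_π_assoc,
          Category.assoc, ← A.map_comp, ← op_comp]
        refine π_comp_map_eq A ?_ _ _ fun x => rfl
        induction ω using Quotient.inductionOn
        rfl }
  map φ :=
    { app := fun S => biproduct.map fun ω => φ.app (Opposite.op (orbit ω))
      naturality := fun S T f => by
        refine biproduct.hom_ext _ _ fun ω => ?_
        simp }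
  map_id A := by
    ext S : 2
    refine biproduct.hom_ext _ _ fun ω => ?_
    simp
  map_comp φ ψ := by
    ext S : 2
    refine biproduct.hom_ext _ _ fun ω => ?_
    simp

variable (G) [Finite G]

/-- The tensor product `A ⊠ B` of coefficient systems: the left Kan extension of
`(S, T) ↦ A(S) ⊗ B(T)` along the cartesian product of finite `G`-sets, restricted to orbits. -/
noncomputable def boxTimes : CoeffSys.{w} G × CoeffSys.{w} G ⥤ CoeffSys.{w} G :=
  (extend G).prod (extend G) ⋙ externalTensor _ _ ⋙ prodOp.lan ⋙
    (Functor.whiskeringLeft _ _ _).obj (isOrbit G).ι.op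

/-- The left Kan extension from coefficient systems to Mackey functors, along the contravariant
inclusion of the orbit category in the Burnside category. -/
noncomputable def toMackey : CoeffSys.{w} G ⥤ Mackey.{w} G :=
  additiveLan.{w} ((isOrbit G).ι.op ⋙ BurnsideCat.ofOp)

end CoeffSys

/-- The box product `M □ N` of Mackey functors: the left Kan extension of
`(S, T) ↦ M(S) ⊗ N(T)` along the cartesian product of the Burnside category. Its universal property
is `Mackey(M □ N, P) = Nat(M(S) ⊗ N(T), P(S × T))`. As biadditive functors form a full subcategory
of all functors in two variables, this is the left adjoint of restriction from additive functors to
biadditive functors, evaluated at the biadditive functor `(S, T) ↦ M(S) ⊗ N(T)`. -/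
noncomputable def Mackey.box (G : Type u) [Group G] [Finite G] :
    Mackey.{w} G × Mackey.{w} G ⥤ Mackey.{w} G :=
  (AdditiveFunctor.forget _ _).prod (AdditiveFunctor.forget _ _) ⋙ externalTensor _ _ ⋙
    additiveLan.{w} BurnsideCat.prod

/-! The proof compares represented functors. Let `L'` be a left adjoint of restriction of additive
functors along a functor `K` that preserves products, and let `*` be the convolution of functors on
the source of `K`. For additive `P`, Hom(L'(F * F'), P) = Hom(F * F', P ∘ K) = Nat(F(S) ⊗ F'(T),
P(K(S) × K(T))) = Nat(L'F(X) ⊗ L'F'(Y), P(X × Y)) = Hom(L'F □ L'F', P). The third equality holds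
because `P(X × Y)` is additive in each variable, so the universal property of `L'` can be used in
one variable with the other fixed (`IsAdditiveExtension.externalTensor`). By Yoneda, `L'` takes `*`
to `□` (`convolutionIso`).

This does not apply to `L` directly, since a product of orbits is rarely an orbit. It applies to `K
= BurnsideCat.ofOp` on all finite `G`-sets, with `L'` equal to `restrict` followed by `toMackey`. To
see that this is a left adjoint, two facts are needed. First, a finite `G`-set has finitely many
orbits and finite direct sums are products, so `extend` is right adjoint to `restrict`
(`restrictAdjunction`), with invertible counit. Second, in the Burnside category a finite `G`-set is
the biproduct of its orbits, through restrictions and transfers, so an additive functor is recovered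
from its values on orbits (`isIso_toExtend_app`). Hence restriction along `ofOp` is restriction to
orbits followed by `extend`, and its left adjoint is `L'` (`restrictToMackeyAdjunction`).

Now `L(A ⊠ B)` is `L'(extend A * extend B)` by definition, which becomes `L'(extend A) □ L'(extend
B)`, and the counit identifies `L'(extend A)` with `L(A)`. -/

/-! ### Extension of coefficient systems as a right adjoint -/

namespace CoeffSys

open FinGSet

variable {G : Type u} [Group G]

/-- The inclusion of an orbit of a finite `G`-set. -/
def orbitIncl {S : FinGSet G} (ω : Orbits S) : (orbit ω).obj ⟶ S :=
  homMk (S := (orbit ω).obj) (fun x : ω.orbit => x.1) fun _ _ => rfl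

theorem subsingleton_orbits (X : OrbitCat G) : Subsingleton (Orbits X.obj) :=
  have := X.property.2
  (MulAction.pretransitive_iff_subsingleton_quotient G X.obj.V).1 this

/-- The orbit of a transitive `G`-set. -/
noncomputable def theOrbit (X : OrbitCat G) : Orbits X.obj :=
  Quotient.mk _ (Classical.choice X.property.1)

/-- The identification of a transitive `G`-set with its unique orbit. -/
def toOrbit (X : OrbitCat G) (ω : Orbits X.obj) : X ⟶ orbit ω :=
  ⟨homMk (T := (orbit ω).obj)
    (fun x => (⟨x, MulAction.orbitRel.Quotient.mem_orbit.2
      ((subsingleton_orbits X).elim _ _)⟩ : ω.orbit))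
    fun _ _ => rfl⟩

/-- The projection of the extension of a coefficient system to the summand of an orbit. -/
noncomputable def proj (A : CoeffSys.{w} G) {S : FinGSet G} (ω : Orbits S) :
    ((extend G).obj A).obj (Opposite.op S) ⟶ A.obj (Opposite.op (orbit ω)) :=
  biproduct.π (fun ω : Orbits S => A.obj (Opposite.op (orbit ω))) ω

theorem extend_hom_ext {A : CoeffSys.{w} G} {S : FinGSet G} {Z : AddCommGrpCat.{w}}
    {f g : Z ⟶ ((extend G).obj A).obj (Opposite.op S)}
    (h : ∀ ω : Orbits S, f ≫ proj A ω = g ≫ proj A ω) : f = g :=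
  biproduct.hom_ext _ _ h

theorem extend_map_proj (A : CoeffSys.{w} G) {S T : FinGSet G} (f : S ⟶ T) (ω : Orbits S) :
    ((extend G).obj A).map f.op ≫ proj A ω = proj A (orbitsMap f ω) ≫ A.map (orbitMap f ω).op :=
  biproduct.lift_π _ _

theorem extend_map_proj_assoc (A : CoeffSys.{w} G) {S T : FinGSet G} (f : S ⟶ T) (ω : Orbits S)
    {Z : AddCommGrpCat.{w}} (h : A.obj (Opposite.op (orbit ω)) ⟶ Z) :
    ((extend G).obj A).map f.op ≫ proj A ω ≫ h =
      proj A (orbitsMap f ω) ≫ A.map (orbitMap f ω).op ≫ h := by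
  rw [← Category.assoc, extend_map_proj, Category.assoc]

theorem extend_app_proj {A B : CoeffSys.{w} G} (φ : A ⟶ B) {S : FinGSet G} (ω : Orbits S) :
    ((extend G).map φ).app (Opposite.op S) ≫ proj B ω = proj A ω ≫ φ.app (Opposite.op (orbit ω)) :=
  biproduct.map_π (fun ω : Orbits S => φ.app (Opposite.op (orbit ω))) ω

theorem extend_app_proj_assoc {A B : CoeffSys.{w} G} (φ : A ⟶ B) {S : FinGSet G} (ω : Orbits S)
    {Z : AddCommGrpCat.{w}} (h : B.obj (Opposite.op (orbit ω)) ⟶ Z) :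
    ((extend G).map φ).app (Opposite.op S) ≫ proj B ω ≫ h =
      proj A ω ≫ φ.app (Opposite.op (orbit ω)) ≫ h := by
  rw [← Category.assoc, extend_app_proj, Category.assoc]

/-- Equal orbits `ω = ω'` need not be definitionally equal, so the two summands have different
types. Comparing the projections after a map out of a common orbit `X` avoids transport along the
equality. -/
theorem proj_comp_map_eq (A : CoeffSys.{w} G) {T : FinGSet G} {X : OrbitCat G} {ω ω' : Orbits T}
    (h : ω = ω') (f : X ⟶ orbit ω) (f' : X ⟶ orbit ω')
    (hf : ∀ x : X.obj.V, (fn f.hom x : ω.orbit).1 = (fn f'.hom x : ω'.orbit).1) :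
    proj A ω ≫ A.map f.op = proj A ω' ≫ A.map f'.op :=
  π_comp_map_eq A h f f' hf

/-- The morphism to the value of an extension with given components. -/
noncomputable def liftExtend (A : CoeffSys.{w} G) {S : FinGSet G} {Z : AddCommGrpCat.{w}}
    (f : ∀ ω : Orbits S, Z ⟶ A.obj (Opposite.op (orbit ω))) :
    Z ⟶ ((extend G).obj A).obj (Opposite.op S) :=
  biproduct.lift f

theorem liftExtend_proj (A : CoeffSys.{w} G) {S : FinGSet G} {Z : AddCommGrpCat.{w}}
    (f : ∀ ω : Orbits S, Z ⟶ A.obj (Opposite.op (orbit ω))) (ω : Orbits S) :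
    liftExtend A f ≫ proj A ω = f ω :=
  biproduct.lift_π _ _

theorem liftExtend_proj_assoc (A : CoeffSys.{w} G) {S : FinGSet G} {Y Z : AddCommGrpCat.{w}}
    (f : ∀ ω : Orbits S, Z ⟶ A.obj (Opposite.op (orbit ω))) (ω : Orbits S)
    (h : A.obj (Opposite.op (orbit ω)) ⟶ Y) :
    liftExtend A f ≫ proj A ω ≫ h = f ω ≫ h := by
  rw [← Category.assoc, liftExtend_proj]

/-- Restriction of functors on finite `G`-sets to orbits. -/
abbrev restrict (G : Type u) [Group G] :
    ((FinGSet G)ᵒᵖ ⥤ AddCommGrpCat.{w}) ⥤ CoeffSys.{w} G :=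
  (Functor.whiskeringLeft _ _ _).obj (isOrbit G).ι.op

/-- The natural map `Q(S) ⟶ ⨁ Q(ω)`, where `ω` runs through the orbits of `S`. -/
noncomputable def toExtend (Q : (FinGSet G)ᵒᵖ ⥤ AddCommGrpCat.{w}) :
    Q ⟶ (extend G).obj ((restrict G).obj Q) where
  app S := liftExtend ((restrict G).obj Q) fun ω : Orbits S.unop => Q.map (orbitIncl ω).op
  naturality S T f := by
    refine extend_hom_ext fun ω => ?_
    rw [Category.assoc, Category.assoc, liftExtend_proj]
    refine Eq.trans ?_ (congrArg _ (extend_map_proj _ f.unop ω).symm)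
    rw [liftExtend_proj_assoc]
    -- Both sides are `Q` of the same map: the inclusion of `ω` followed by `f` is the restriction
    -- `ω ⟶ f(ω)` followed by the inclusion of `f(ω)`.
    exact (Q.map_comp _ _).symm.trans (Q.map_comp (orbitIncl (orbitsMap f.unop ω)).op (orbitMap f.unop ω).hom.op)

theorem toExtend_app_proj (Q : (FinGSet G)ᵒᵖ ⥤ AddCommGrpCat.{w}) {S : FinGSet G}
    (ω : Orbits S) :
    (toExtend Q).app (Opposite.op S) ≫ proj ((restrict G).obj Q) ω = Q.map (orbitIncl ω).op :=
  liftExtend_proj _ _ ω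

theorem toExtend_app_proj_assoc (Q : (FinGSet G)ᵒᵖ ⥤ AddCommGrpCat.{w}) {S : FinGSet G}
    (ω : Orbits S) {Z : AddCommGrpCat.{w}} (h : Q.obj (Opposite.op (orbit ω).obj) ⟶ Z) :
    (toExtend Q).app (Opposite.op S) ≫ proj ((restrict G).obj Q) ω ≫ h =
      Q.map (orbitIncl ω).op ≫ h := by
  rw [← Category.assoc, toExtend_app_proj]

/-- The value of the extension of `A` at an orbit is the value of `A`. -/
noncomputable def fromExtend (A : CoeffSys.{w} G) : (restrict G).obj ((extend G).obj A) ⟶ A where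
  app X := proj A (theOrbit X.unop) ≫ A.map (toOrbit X.unop _).op
  naturality X Y f := by
    refine (extend_map_proj_assoc A f.unop.hom (theOrbit Y.unop) _).trans ?_
    rw [Category.assoc]
    refine (congrArg _ (A.map_comp _ _).symm).trans
      (Eq.trans ?_ (congrArg _ (A.map_comp _ f)))
    exact proj_comp_map_eq A ((subsingleton_orbits _).elim _ _)
      (toOrbit Y.unop (theOrbit Y.unop) ≫ orbitMap f.unop.hom (theOrbit Y.unop))
      (f.unop ≫ toOrbit X.unop (theOrbit X.unop)) fun x => rfl

theorem toExtend_naturality {Q R : (FinGSet G)ᵒᵖ ⥤ AddCommGrpCat.{w}} (φ : Q ⟶ R) :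
    φ ≫ toExtend R = toExtend Q ≫ (extend G).map ((restrict G).map φ) := by
  ext S : 2
  refine extend_hom_ext fun ω => ?_
  refine (Category.assoc _ _ _).trans ?_
  refine (congrArg (φ.app S ≫ ·) (toExtend_app_proj R ω)).trans ?_
  refine (φ.naturality _).symm.trans ?_
  refine Eq.trans ?_ (Category.assoc _ _ _).symm
  refine Eq.trans ?_ (congrArg ((toExtend Q).app S ≫ ·) (extend_app_proj ((restrict G).map φ) ω).symm)
  exact (toExtend_app_proj_assoc Q ω _).symm

theorem fromExtend_naturality {A B : CoeffSys.{w} G} (φ : A ⟶ B) :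
    (restrict G).map ((extend G).map φ) ≫ fromExtend B = fromExtend A ≫ φ := by
  ext X : 2
  refine (extend_app_proj_assoc φ (theOrbit X.unop) _).trans ?_
  refine (congrArg _ (φ.naturality _).symm).trans (Category.assoc _ _ _).symm

/-- First triangle identity: identifying `X` with its only orbit and then including that orbit in
`X` is the identity. -/
theorem toExtend_restrict (Q : (FinGSet G)ᵒᵖ ⥤ AddCommGrpCat.{w}) :
    (restrict G).map (toExtend Q) ≫ fromExtend ((restrict G).obj Q) = 𝟙 _ := by
  ext X : 2
  refine (toExtend_app_proj_assoc Q (theOrbit X.unop) _).trans ?_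
  exact (Q.map_comp _ _).symm.trans (Q.map_id _)

/-- Second triangle identity. On the summand of `ω` it holds because `ω`, as a `G`-set, has one
orbit, whose image in `S` is `ω` again. -/
theorem toExtend_extend (A : CoeffSys.{w} G) :
    toExtend ((extend G).obj A) ≫ (extend G).map (fromExtend A) = 𝟙 _ := by
  ext S : 2
  refine extend_hom_ext fun ω => ?_
  refine (Category.assoc _ _ _).trans ?_
  refine (congrArg ((toExtend ((extend G).obj A)).app S ≫ ·)
    (extend_app_proj (fromExtend A) ω)).trans ?_
  refine (toExtend_app_proj_assoc ((extend G).obj A) ω _).trans ?_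
  refine (extend_map_proj_assoc A (orbitIncl ω) (theOrbit (orbit ω)) _).trans ?_
  refine (congrArg _ (A.map_comp _ _).symm).trans ?_
  refine (proj_comp_map_eq A (ω' := ω) ?_
    (toOrbit (orbit ω) (theOrbit (orbit ω)) ≫ orbitMap (orbitIncl ω) (theOrbit (orbit ω)))
    (𝟙 _) fun x => rfl).trans ?_
  -- `theOrbit` rests on a choice of point. The claim holds for every orbit of `ω`, where a
  -- representative can be taken.
  · generalize theOrbit (orbit ω) = ω'
    induction ω' using Quotient.inductionOn with | _ x
    exact MulAction.orbitRel.Quotient.mem_orbit.1 x.2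
  · exact (congrArg _ (A.map_id _)).trans ((Category.comp_id _).trans (Category.id_comp _).symm)

/-- Extension of coefficient systems is right adjoint to restriction to orbits. -/
noncomputable def restrictAdjunction (G : Type u) [Group G] :
    restrict.{w} G ⊣ extend.{w} G :=
  Adjunction.mk'
    { homEquiv := fun Q A =>
        { toFun := fun φ => toExtend Q ≫ (extend G).map φ
          invFun := fun ψ => (restrict G).map ψ ≫ fromExtend A
          left_inv := fun φ => by
            dsimp only
            rw [Functor.map_comp, Category.assoc, fromExtend_naturality, ← Category.assoc,
              toExtend_restrict, Category.id_comp]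
          right_inv := fun ψ => by
            dsimp only
            rw [Functor.map_comp, ← Category.assoc, ← toExtend_naturality, Category.assoc,
              toExtend_extend, Category.comp_id] }
      unit := { app := toExtend, naturality := fun _ _ φ => toExtend_naturality φ }
      counit := { app := fromExtend, naturality := fun _ _ φ => fromExtend_naturality φ }
      homEquiv_unit := rfl
      homEquiv_counit := rfl }

/-- Over a transitive `G`-set the direct sum has a single summand. Thus `extend` is fully faithful,
which removes it again at the end of the argument. -/
instance (A : CoeffSys.{w} G) : IsIso ((restrictAdjunction G).counit.app A) := by
  have (X : (OrbitCat G)ᵒᵖ) : IsIso ((fromExtend A).app X) := by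
    refine ⟨liftExtend A fun ω => A.map (X := X) (Quiver.Hom.op ⟨orbitIncl ω⟩), ?_, ?_⟩
    · refine extend_hom_ext fun ω => ?_
      rw [Category.assoc, liftExtend_proj]
      refine (Category.assoc _ _ _).trans ?_
      refine (congrArg _ (A.map_comp _ _).symm).trans ?_
      refine (proj_comp_map_eq A ((subsingleton_orbits X.unop).elim (theOrbit X.unop) ω)
        ((⟨orbitIncl ω⟩ : orbit ω ⟶ X.unop) ≫ toOrbit X.unop (theOrbit X.unop)) (𝟙 _)
        fun x => rfl).trans ?_
      exact (congrArg _ (A.map_id _)).trans ((Category.comp_id _).trans (Category.id_comp _).symm)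
    · refine (liftExtend_proj_assoc _ _ _ _).trans ?_
      exact (A.map_comp _ _).symm.trans (A.map_id _)
  exact NatIso.isIso_of_isIso_app (fromExtend A)

end CoeffSys

/-! ### Finite `G`-sets as biproducts of orbits in the Burnside category -/

namespace CoeffSys

open FinGSet

variable {G : Type u} [Group G]

/-- The union of a set of orbits of a finite `G`-set. -/
def unionObj {S : FinGSet G} (s : Finset (Orbits S)) : FinGSet G :=
  letI : MulAction G {x : S.V // (Quotient.mk _ x : Orbits S) ∈ s} :=
    { smul := fun g x => ⟨g • x.1, by
        rw [show (Quotient.mk _ (g • x.1) : Orbits S) = Quotient.mk _ x.1 from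
          Quotient.sound ⟨g, rfl⟩]
        exact x.2⟩
      one_smul := fun x => Subtype.ext (one_smul G x.1)
      mul_smul := fun a b x => Subtype.ext (mul_smul a b x.1) }
  of {x : S.V // (Quotient.mk _ x : Orbits S) ∈ s}

/-- The inclusion of a union of orbits. -/
def unionIncl {S : FinGSet G} (s : Finset (Orbits S)) : unionObj s ⟶ S :=
  homMk (S := unionObj s)
    (fun x : {x : S.V // (Quotient.mk _ x : Orbits S) ∈ s} => x.1) fun _ _ => rfl

/-- Addition of spans is disjoint union, so orbits can be joined one at a time. The case of all
orbits splits the identity span of `S`. -/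
theorem sum_cls_orbitIncl {S : FinGSet G} (s : Finset (Orbits S)) :
    ∑ ω ∈ s, GSpan.cls (GSpan.mk (orbitIncl ω) (orbitIncl ω)) =
      GSpan.cls (GSpan.mk (unionIncl s) (unionIncl s)) := by
  classical
  induction s using Finset.induction_on with
  | empty =>
    rw [Finset.sum_empty]
    have : IsEmpty (GSpan.zero S S).apex.V := inferInstanceAs (IsEmpty (emptyObj : FinGSet G).V)
    have : IsEmpty (unionObj (∅ : Finset (Orbits S))).V :=
      ⟨fun x : {x : S.V // (Quotient.mk _ x : Orbits S) ∈ (∅ : Finset (Orbits S))} =>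
        Finset.notMem_empty _ x.2⟩
    exact GSpan.cls_eq (s := GSpan.zero S S) (t := GSpan.mk (unionIncl ∅) (unionIncl ∅))
      (Equiv.equivOfIsEmpty _ _)
      (fun _ p => isEmptyElim p) (fun p => isEmptyElim p) (fun p => isEmptyElim p)
  | insert ω s hω ih =>
    rw [Finset.sum_insert hω, ih]
    let F : ω.orbit ⊕ {x : S.V // (Quotient.mk _ x : Orbits S) ∈ s} →
        {x : S.V // (Quotient.mk _ x : Orbits S) ∈ insert ω s} :=
      Sum.elim
        (fun x => ⟨x.1, Finset.mem_insert.2 (Or.inl (MulAction.orbitRel.Quotient.mem_orbit.1 x.2))⟩)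
        (fun x => ⟨x.1, Finset.mem_insert.2 (Or.inr x.2)⟩)
    have hF : Function.Bijective F := by
      constructor
      -- Disjointness of `ω` from the union over `s`, from `ω ∉ s`.
      · have key (x : ω.orbit) (y : {x : S.V // (Quotient.mk _ x : Orbits S) ∈ s}) : x.1 ≠ y.1 :=
          fun h => hω (by
            have h1 : Quotient.mk _ x.1 = ω := MulAction.orbitRel.Quotient.mem_orbit.1 x.2
            rw [← h1, h]
            exact y.2)
        rintro (x | x) (y | y) h <;> have h0 := congrArg Subtype.val h
        · exact congrArg Sum.inl (Subtype.ext h0)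
        · exact (key x y h0).elim
        · exact (key y x h0.symm).elim
        · exact congrArg Sum.inr (Subtype.ext h0)
      · rintro ⟨x, hx⟩
        rcases Finset.mem_insert.1 hx with h | h
        · exact ⟨Sum.inl ⟨x, MulAction.orbitRel.Quotient.mem_orbit.2 h⟩, rfl⟩
        · exact ⟨Sum.inr ⟨x, h⟩, rfl⟩
    refine GSpan.cls_eq
      (s := GSpan.add (GSpan.mk (orbitIncl ω) (orbitIncl ω))
        (GSpan.mk (unionIncl s) (unionIncl s)))
      (t := GSpan.mk (unionIncl (insert ω s)) (unionIncl (insert ω s)))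
      (Equiv.ofBijective F hF) ?_ ?_ ?_
    · rintro g (x | x) <;> rfl
    · rintro (x | x) <;> rfl
    · rintro (x | x) <;> rfl

/-- The transfer from an orbit of a finite `G`-set. -/
noncomputable def orbitTransfer {S : FinGSet G} (ω : Orbits S) :
    BurnsideCat.mk (orbit ω).obj ⟶ BurnsideCat.mk S :=
  BurnsideHom.of (GSpan.cls (GSpan.mk (𝟙 _) (orbitIncl ω)))

/-- The restriction to an orbit of a finite `G`-set. -/
noncomputable def orbitRestrict {S : FinGSet G} (ω : Orbits S) :
    BurnsideCat.mk S ⟶ BurnsideCat.mk (orbit ω).obj :=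
  BurnsideCat.ofOp.map (orbitIncl ω).op

/-- The inclusion of `ω` is injective, so the fibre product of `ω` with itself over `S` is the
diagonal. -/
theorem orbitTransfer_comp_orbitRestrict_self {S : FinGSet G} (ω : Orbits S) :
    orbitTransfer ω ≫ orbitRestrict ω = 𝟙 _ := by
  refine (BurnsideHom.comp_of _ _).trans (congrArg BurnsideHom.of ?_)
  exact GSpan.cls_eq
    (s := GSpan.comp (GSpan.mk (𝟙 _) (orbitIncl ω)) (GSpan.mk (orbitIncl ω) (𝟙 _)))
    (t := GSpan.mk (𝟙 _) (𝟙 _))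
    { toFun := fun p => p.1.1
      invFun := fun x => ⟨(x, x), rfl⟩
      left_inv := fun p => Subtype.ext (Prod.ext rfl (Subtype.ext p.2))
      right_inv := fun _ => rfl }
    (fun _ _ => rfl) (fun _ => rfl) (fun p => Subtype.ext p.2)

/-- Distinct orbits are disjoint, so their fibre product over `S` is empty. -/
theorem orbitTransfer_comp_orbitRestrict {S : FinGSet G} {ω ω' : Orbits S} (h : ω ≠ ω') :
    orbitTransfer ω ≫ orbitRestrict ω' = 0 := by
  refine (BurnsideHom.comp_of _ _).trans (Eq.trans (congrArg BurnsideHom.of ?_)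
    (map_zero BurnsideHom.of))
  have : IsEmpty
      (GSpan.comp (GSpan.mk (𝟙 _) (orbitIncl ω)) (GSpan.mk (orbitIncl ω') (𝟙 _))).apex.V :=
    ⟨fun p => h (by
      have h1 : Quotient.mk _ p.1.1.1 = ω := MulAction.orbitRel.Quotient.mem_orbit.1 p.1.1.2
      have h2 : Quotient.mk _ p.1.2.1 = ω' := MulAction.orbitRel.Quotient.mem_orbit.1 p.1.2.2
      have h3 : p.1.1.1 = p.1.2.1 := p.2
      exact h1.symm.trans ((congrArg (Quotient.mk _) h3).trans h2))⟩
  have : IsEmpty (GSpan.zero (orbit ω).obj (orbit ω').obj).apex.V :=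
    inferInstanceAs (IsEmpty (emptyObj : FinGSet G).V)
  exact GSpan.cls_eq
    (s := GSpan.comp (GSpan.mk (𝟙 _) (orbitIncl ω)) (GSpan.mk (orbitIncl ω') (𝟙 _)))
    (t := GSpan.zero _ _) (Equiv.equivOfIsEmpty _ _)
    (fun _ p => isEmptyElim p) (fun p => isEmptyElim p) (fun p => isEmptyElim p)

theorem orbitRestrict_comp_orbitTransfer {S : FinGSet G} (ω : Orbits S) :
    orbitRestrict ω ≫ orbitTransfer ω =
      BurnsideHom.of (GSpan.cls (GSpan.mk (orbitIncl ω) (orbitIncl ω))) := by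
  refine (BurnsideHom.comp_of _ _).trans (congrArg BurnsideHom.of ?_)
  exact GSpan.cls_eq
    (s := GSpan.comp (GSpan.mk (orbitIncl ω) (𝟙 _)) (GSpan.mk (𝟙 _) (orbitIncl ω)))
    (t := GSpan.mk (orbitIncl ω) (orbitIncl ω))
    { toFun := fun p => p.1.1
      invFun := fun x => ⟨(x, x), rfl⟩
      left_inv := fun p => Subtype.ext (Prod.ext rfl p.2)
      right_inv := fun _ => rfl }
    (fun _ _ => rfl) (fun _ => rfl) (fun p => congrArg Subtype.val p.2)

/-- With the two preceding orthogonality relations, this exhibits `S` as the biproduct of its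
orbits. -/
theorem sum_orbitRestrict_comp_orbitTransfer {S : FinGSet G} [Fintype (Orbits S)] :
    ∑ ω : Orbits S, orbitRestrict ω ≫ orbitTransfer ω = 𝟙 (BurnsideCat.mk S) := by
  simp only [orbitRestrict_comp_orbitTransfer]
  refine (map_sum BurnsideHom.of _ _).symm.trans (congrArg BurnsideHom.of ?_)
  rw [sum_cls_orbitIncl]
  exact GSpan.cls_eq (s := GSpan.mk (unionIncl Finset.univ) (unionIncl Finset.univ))
    (t := GSpan.mk (𝟙 S) (𝟙 S))
    { toFun := fun x => x.1
      invFun := fun x => ⟨x, Finset.mem_univ _⟩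
      left_inv := fun _ => rfl
      right_inv := fun _ => rfl }
    (fun _ _ => rfl) (fun _ => rfl) (fun _ => rfl)

/-- Mackey functors take disjoint unions to direct sums. -/
theorem isIso_toExtend_app (P : BurnsideCat G ⥤ AddCommGrpCat.{w}) [P.Additive] (S : FinGSet G) :
    IsIso ((toExtend (BurnsideCat.ofOp ⋙ P)).app (Opposite.op S)) := by
  classical
  let : Fintype (Orbits S) := Fintype.ofFinite _
  let p (ω : Orbits S) : ((extend G).obj ((restrict G).obj (BurnsideCat.ofOp ⋙ P))).obj
      (Opposite.op S) ⟶ P.obj (BurnsideCat.mk (orbit ω).obj) := proj _ ω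
  have hp (ω : Orbits S) {Z} (h : P.obj (BurnsideCat.mk (orbit ω).obj) ⟶ Z) :
      (toExtend (BurnsideCat.ofOp ⋙ P)).app (Opposite.op S) ≫ p ω ≫ h =
        P.map (orbitRestrict ω) ≫ h :=
    toExtend_app_proj_assoc (BurnsideCat.ofOp ⋙ P) ω h
  have hsum : ∑ ω : Orbits S, P.map (orbitRestrict ω) ≫ P.map (orbitTransfer ω) =
      𝟙 (P.obj (BurnsideCat.mk S)) := by
    simp only [← P.map_comp]
    rw [← P.map_sum, sum_orbitRestrict_comp_orbitTransfer, P.map_id]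
  -- The inverse adds up the transfers from the orbits. The biproduct relations, preserved by the
  -- additive functor `P`, show that it is inverse on both sides.
  refine ⟨∑ ω : Orbits S, p ω ≫ P.map (orbitTransfer ω), ?_, ?_⟩
  · refine (Preadditive.comp_sum _ _ _).trans ?_
    refine (Finset.sum_congr rfl fun ω _ => hp ω _).trans hsum
  · refine extend_hom_ext fun ω => ?_
    refine (Category.assoc _ _ _).trans ?_
    refine Eq.trans (b := (∑ ω' : Orbits S, p ω' ≫ P.map (orbitTransfer ω')) ≫
      P.map (orbitRestrict ω)) (congrArg _ (toExtend_app_proj _ ω)) ?_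
    refine Eq.trans ?_ (Category.id_comp (p ω)).symm
    simp only [Preadditive.sum_comp, Category.assoc, ← P.map_comp]
    rw [Finset.sum_eq_single ω]
    · rw [orbitTransfer_comp_orbitRestrict_self, P.map_id, Category.comp_id]
    · intro ω' _ hω'
      rw [orbitTransfer_comp_orbitRestrict hω', P.map_zero, comp_zero]
    · exact fun h => (h (Finset.mem_univ _)).elim

instance (P : BurnsideCat G ⥤ AddCommGrpCat.{w}) [P.Additive] :
    IsIso ((restrictAdjunction G).unit.app (BurnsideCat.ofOp ⋙ P)) :=
  have (S : (FinGSet G)ᵒᵖ) : IsIso ((toExtend (BurnsideCat.ofOp ⋙ P)).app S) :=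
    isIso_toExtend_app P S.unop
  NatIso.isIso_of_isIso_app (toExtend (BurnsideCat.ofOp ⋙ P))

end CoeffSys

/-! ### Additive extensions and external tensor products -/

section ExternalTensor

universe v₁ u₁

variable {C : Type u₁} [Category.{v₁} C] {D : Type u₁} [Category.{v₁} D]

/-- An elementary tensor in the external tensor product. -/
noncomputable def extTmul {F : C ⥤ AddCommGrpCat.{w}} {H : D ⥤ AddCommGrpCat.{w}} {c : C} {d : D}
    (x : F.obj c) (y : H.obj d) : ((externalTensor C D).obj (F, H)).obj (c, d) :=
  x ⊗ₜ[ℤ] y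

variable {F : C ⥤ AddCommGrpCat.{w}} {H : D ⥤ AddCommGrpCat.{w}}

theorem extTmul_add {c : C} {d : D} (x : F.obj c) (y y' : H.obj d) :
    extTmul x (y + y') = extTmul x y + extTmul x y' :=
  TensorProduct.tmul_add _ _ _

theorem add_extTmul {c : C} {d : D} (x x' : F.obj c) (y : H.obj d) :
    extTmul (x + x') y = extTmul x y + extTmul x' y :=
  TensorProduct.add_tmul _ _ _

theorem externalTensor_obj_hom_ext {c : C} {d : D} {Z : AddCommGrpCat.{w}}
    {f g : ((externalTensor C D).obj (F, H)).obj (c, d) ⟶ Z}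
    (h : ∀ (x : F.obj c) (y : H.obj d), f (extTmul x y) = g (extTmul x y)) : f = g := by
  ext t
  refine TensorProduct.induction_on (motive := fun t : F.obj c ⊗[ℤ] H.obj d => f t = g t) t ?_ h
    fun s t hs ht => ?_
  · exact (map_zero f.hom).trans (map_zero g.hom).symm
  · exact (map_add f.hom s t).trans ((congrArg₂ (· + ·) hs ht).trans (map_add g.hom s t).symm)

theorem externalTensor_hom_ext {R : C × D ⥤ AddCommGrpCat.{w}}
    {φ ψ : (externalTensor C D).obj (F, H) ⟶ R}
    (h : ∀ (c : C) (d : D) (x : F.obj c) (y : H.obj d),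
      φ.app (c, d) (extTmul x y) = ψ.app (c, d) (extTmul x y)) : φ = ψ := by
  ext ⟨c, d⟩ : 2
  exact externalTensor_obj_hom_ext (h c d)

theorem externalTensor_naturality {R : C × D ⥤ AddCommGrpCat.{w}}
    (φ : (externalTensor C D).obj (F, H) ⟶ R) {c c' : C} {d d' : D} (f : c ⟶ c') (g : d ⟶ d')
    (x : F.obj c) (y : H.obj d) :
    φ.app (c', d') (extTmul (F.map f x) (H.map g y)) =
      R.map (X := (c, d)) (Y := (c', d')) (f, g) (φ.app (c, d) (extTmul x y)) :=
  ConcreteCategory.congr_hom (φ.naturality (X := (c, d)) (Y := (c', d')) (f, g)) (extTmul x y)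

/-- A natural family of biadditive maps, as a morphism from the external tensor product. -/
noncomputable def externalTensorDesc {R : C × D ⥤ AddCommGrpCat.{w}}
    (χ : ∀ (c : C) (d : D), F.obj c →+ H.obj d →+ R.obj (c, d))
    (hχ : ∀ {c c' : C} {d d' : D} (f : c ⟶ c') (g : d ⟶ d') (x : F.obj c) (y : H.obj d),
      χ c' d' (F.map f x) (H.map g y) = R.map (X := (c, d)) (Y := (c', d')) (f, g) (χ c d x y)) :
    (externalTensor C D).obj (F, H) ⟶ R where
  app p := AddCommGrpCat.ofHom (TensorProduct.liftAddHom (χ p.1 p.2) fun r x y => by simp)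
  naturality _ _ f := externalTensor_obj_hom_ext fun x y => hχ f.1 f.2 x y

end ExternalTensor

/-! ### Universal property of additive extensions in two variables -/

section AdditiveExtension

universe v₁ u₁ v₂ u₂

variable {C : Type u₁} [Category.{v₁} C] {D : Type u₂} [Category.{v₂} D] [Preadditive D]
  {C' : Type u₁} [Category.{v₁} C'] {D' : Type u₂} [Category.{v₂} D'] [Preadditive D']
  {K : C ⥤ D} {K' : C' ⥤ D'}

/-- `η : F ⟶ K ⋙ M` has the universal property of the additive left Kan extension of `F` along
`K`. -/
def IsAdditiveExtension {F : C ⥤ AddCommGrpCat.{w}} {M : D ⥤ AddCommGrpCat.{w}}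
    (η : F ⟶ K ⋙ M) : Prop :=
  ∀ (Q : D ⥤ AddCommGrpCat.{w}) [Q.Additive],
    Function.Bijective fun φ : M ⟶ Q => η ≫ Functor.whiskerLeft K φ

/-- The external tensor product of two morphisms to restricted functors. -/
noncomputable def externalTensorMap {F : C ⥤ AddCommGrpCat.{w}} {M : D ⥤ AddCommGrpCat.{w}}
    {F' : C' ⥤ AddCommGrpCat.{w}} {M' : D' ⥤ AddCommGrpCat.{w}} (η : F ⟶ K ⋙ M)
    (η' : F' ⟶ K' ⋙ M') :
    (externalTensor C C').obj (F, F') ⟶ K.prod K' ⋙ (externalTensor D D').obj (M, M') :=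
  (externalTensor C C').map (X := (F, F')) (Y := (K ⋙ M, K' ⋙ M')) (η, η')

/-- The map of sections induced by a morphism of the second variable. -/
def sectLMap (R : C × C' ⥤ AddCommGrpCat.{w}) {c d : C'} (g : c ⟶ d) :
    Prod.sectL C c ⋙ R ⟶ Prod.sectL C d ⋙ R where
  app x := R.map (X := (x, c)) (Y := (x, d)) (𝟙 x, g)
  naturality x y f := by
    refine (R.map_comp _ _).symm.trans (Eq.trans ?_ (R.map_comp _ _))
    refine congrArg R.map (Prod.ext ?_ ?_)
    · exact (Category.comp_id f).trans (Category.id_comp f).symm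
    · exact (Category.id_comp g).trans (Category.comp_id g).symm

/-- The map of sections induced by a morphism of the first variable. -/
def sectRMap (R : C × C' ⥤ AddCommGrpCat.{w}) {c d : C} (f : c ⟶ d) :
    Prod.sectR c C' ⋙ R ⟶ Prod.sectR d C' ⋙ R where
  app x := R.map (X := (c, x)) (Y := (d, x)) (f, 𝟙 x)
  naturality x y g := by
    refine (R.map_comp _ _).symm.trans (Eq.trans ?_ (R.map_comp _ _))
    refine congrArg R.map (Prod.ext ?_ ?_)
    · exact (Category.id_comp f).trans (Category.comp_id f).symm
    · exact (Category.comp_id g).trans (Category.id_comp g).symm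

/-- Restriction of a morphism from an external tensor product to an element of the second
factor. -/
noncomputable def sliceL {F : C ⥤ AddCommGrpCat.{w}} {F' : C' ⥤ AddCommGrpCat.{w}}
    {R : D × D' ⥤ AddCommGrpCat.{w}}
    (ψ : (externalTensor C C').obj (F, F') ⟶ K.prod K' ⋙ R) {c' : C'} (y : F'.obj c') :
    F ⟶ K ⋙ Prod.sectL D (K'.obj c') ⋙ R where
  app c := AddCommGrpCat.ofHom (AddMonoidHom.mk' (fun x => ψ.app (c, c') (extTmul x y))
    fun x x' => by rw [add_extTmul]; exact map_add (ψ.app (c, c')).hom _ _)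
  naturality c d f := by
    ext x
    have := externalTensor_naturality ψ f (𝟙 c') x y
    rw [F'.map_id] at this
    refine this.trans ?_
    exact congrArg (fun g => R.map (X := (K.obj c, K'.obj c')) (Y := (K.obj d, K'.obj c'))
      (K.map f, g) _) (K'.map_id c')

/-- Restriction of a morphism from an external tensor product to an element of the first
factor. -/
noncomputable def sliceR {F : C ⥤ AddCommGrpCat.{w}} {F' : C' ⥤ AddCommGrpCat.{w}}
    {R : C × C' ⥤ AddCommGrpCat.{w}}
    (ψ : (externalTensor C C').obj (F, F') ⟶ R) {c : C} (x : F.obj c) :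
    F' ⟶ Prod.sectR c C' ⋙ R where
  app c' := AddCommGrpCat.ofHom (AddMonoidHom.mk' (fun y => ψ.app (c, c') (extTmul x y))
    fun y y' => by rw [extTmul_add]; exact map_add (ψ.app (c, c')).hom _ _)
  naturality c' d' f := by
    ext y
    have := externalTensor_naturality ψ (𝟙 c) f x y
    rw [F.map_id] at this
    exact this

namespace IsAdditiveExtension

variable {F : C ⥤ AddCommGrpCat.{w}} {M : D ⥤ AddCommGrpCat.{w}} {η : F ⟶ K ⋙ M}
  {F' : C' ⥤ AddCommGrpCat.{w}} {M' : D' ⥤ AddCommGrpCat.{w}} {η' : F' ⟶ K' ⋙ M'}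

theorem hom_ext (h : IsAdditiveExtension η) {Q : D ⥤ AddCommGrpCat.{w}} [Q.Additive]
    {φ ψ : M ⟶ Q}
    (e : ∀ (c : C) (x : F.obj c), φ.app (K.obj c) (η.app c x) = ψ.app (K.obj c) (η.app c x)) :
    φ = ψ := by
  refine (h Q).1 ?_
  ext c x
  exact e c x

theorem exists_desc (h : IsAdditiveExtension η) {Q : D ⥤ AddCommGrpCat.{w}} [Q.Additive]
    (ψ : F ⟶ K ⋙ Q) :
    ∃ φ : M ⟶ Q, ∀ (c : C) (x : F.obj c), φ.app (K.obj c) (η.app c x) = ψ.app c x := by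
  obtain ⟨φ, hφ⟩ := (h Q).2 ψ
  refine ⟨φ, fun c x => ?_⟩
  rw [← hφ]
  rfl

/-- The external tensor product of additive extensions is universal for functors which are additive
in each variable. -/
theorem externalTensor (h : IsAdditiveExtension η) (h' : IsAdditiveExtension η')
    (R : D × D' ⥤ AddCommGrpCat.{w}) (hR : ∀ d', (Prod.sectL D d' ⋙ R).Additive)
    (hR' : ∀ d, (Prod.sectR d D' ⋙ R).Additive) :
    Function.Bijective fun φ : (externalTensor D D').obj (M, M') ⟶ R =>
      externalTensorMap η η' ≫ Functor.whiskerLeft (K.prod K') φ := by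
  constructor
  · intro φ₁ φ₂ e
    have e (c : C) (c' : C') (x : F.obj c) (y : F'.obj c') :
        φ₁.app (K.obj c, K'.obj c') (extTmul (η.app c x) (η'.app c' y)) =
          φ₂.app (K.obj c, K'.obj c') (extTmul (η.app c x) (η'.app c' y)) :=
      ConcreteCategory.congr_hom (NatTrans.congr_app e (c, c')) (extTmul x y)
    -- Uniqueness, one variable at a time: with `y` fixed, agreement passes from the elements `η x`
    -- to all `m`. Then, with `m` fixed, it passes from the elements `η' y` to all `n`.
    have e' (d : D) (c' : C') (m : M.obj d) (y : F'.obj c') :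
        φ₁.app (d, K'.obj c') (extTmul m (η'.app c' y)) =
          φ₂.app (d, K'.obj c') (extTmul m (η'.app c' y)) :=
      have := hR (K'.obj c')
      ConcreteCategory.congr_hom (NatTrans.congr_app (h.hom_ext
        (Q := Prod.sectL D (K'.obj c') ⋙ R)
        (φ := sliceL (K := 𝟭 D) (K' := 𝟭 D') φ₁ (η'.app c' y))
        (ψ := sliceL (K := 𝟭 D) (K' := 𝟭 D') φ₂ (η'.app c' y)) fun c x => e c c' x y) d) m
    refine externalTensor_hom_ext fun d d' m n => ?_
    have := hR' d
    exact ConcreteCategory.congr_hom (NatTrans.congr_app (h'.hom_ext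
      (Q := Prod.sectR d D' ⋙ R) (φ := sliceR φ₁ m) (ψ := sliceR φ₂ m)
      fun c' y => e' d c' m y) d') n
  · intro ψ
    have := hR
    have := hR'
    -- Existence: for fixed `y`, extend `ψ` in the first variable. Uniqueness of the extension makes
    -- `α` additive and natural in `y`.
    choose α hα using fun (c' : C') (y : F'.obj c') =>
      h.exists_desc (Q := Prod.sectL D (K'.obj c') ⋙ R) (sliceL ψ y)
    have α_add (c' : C') (y y' : F'.obj c') : α c' (y + y') = α c' y + α c' y' :=
      h.hom_ext fun c x => by
        refine (hα _ _ _ _).trans (Eq.trans ?_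
          (congrArg₂ (· + ·) (hα _ _ _ _) (hα _ _ _ _)).symm)
        exact (congrArg _ (extTmul_add _ _ _)).trans (map_add (ψ.app (c, c')).hom _ _)
    have α_nat {c' d' : C'} (g : c' ⟶ d') (y : F'.obj c') :
        α d' (F'.map g y) = α c' y ≫ sectLMap R (K'.map g) :=
      h.hom_ext fun c x => by
        refine (hα _ _ _ _).trans (Eq.trans ?_ (congrArg _ (hα _ _ _ _)).symm)
        have := externalTensor_naturality ψ (𝟙 c) g x y
        rw [F.map_id] at this
        refine this.trans ?_
        exact congrArg (fun f => R.map (X := (K.obj c, K'.obj c')) (Y := (K.obj c, K'.obj d'))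
          (f, K'.map g) _) (K.map_id c)
    -- For fixed `m`, the values of `α` are natural in `y`, so they extend in the second variable to
    -- `χ`. Uniqueness again gives additivity and naturality in `m`.
    let β (d : D) (m : M.obj d) : F' ⟶ K' ⋙ Prod.sectR d D' ⋙ R :=
      { app := fun c' => AddCommGrpCat.ofHom (AddMonoidHom.mk' (fun y => (α c' y).app d m)
          fun y y' => by rw [α_add]; rfl)
        naturality := fun c' d' g => by
          ext y
          exact ConcreteCategory.congr_hom (NatTrans.congr_app (α_nat g y) d) m }
    choose χ hχ using fun (d : D) (m : M.obj d) =>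
      h'.exists_desc (Q := Prod.sectR d D' ⋙ R) (β d m)
    have χ_add (d : D) (m m' : M.obj d) : χ d (m + m') = χ d m + χ d m' :=
      h'.hom_ext fun c' y => by
        refine (hχ _ _ _ _).trans (Eq.trans ?_
          (congrArg₂ (· + ·) (hχ _ _ _ _) (hχ _ _ _ _)).symm)
        exact map_add ((α c' y).app d).hom m m'
    have χ_nat {d₁ d₂ : D} (f : d₁ ⟶ d₂) (m : M.obj d₁) :
        χ d₂ (M.map f m) = χ d₁ m ≫ sectRMap R f :=
      h'.hom_ext fun c' y => by
        refine (hχ _ _ _ _).trans (Eq.trans ?_ (congrArg _ (hχ _ _ _ _)).symm)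
        exact ConcreteCategory.congr_hom ((α c' y).naturality f) m
    refine ⟨externalTensorDesc (fun d d' => AddMonoidHom.mk' (fun m => ((χ d m).app d').hom)
      fun m m' => by rw [χ_add]; rfl) ?_, ?_⟩
    · intro d₁ d₂ d₁' d₂' f g m n
      refine (ConcreteCategory.congr_hom ((χ d₂ (M.map f m)).naturality g) n).trans ?_
      refine (congrArg (fun t : M' ⟶ Prod.sectR d₂ D' ⋙ R =>
        (Prod.sectR d₂ D' ⋙ R).map g (t.app d₁' n)) (χ_nat f m)).trans ?_
      -- Naturality in both variables together, from `(f, g) = (f, 𝟙) ≫ (𝟙, g)`.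
      refine (ConcreteCategory.congr_hom (R.map_comp (X := (d₁, d₁')) (Y := (d₂, d₁'))
        (Z := (d₂, d₂')) (f, 𝟙 _) (𝟙 _, g)) ((χ d₁ m).app d₁' n)).symm.trans ?_
      exact congrArg (fun t => R.map (X := (d₁, d₁')) (Y := (d₂, d₂')) t ((χ d₁ m).app d₁' n))
        (Prod.ext (Category.comp_id f) (Category.id_comp g))
    · refine externalTensor_hom_ext fun c c' x y => ?_
      exact (hχ _ _ _ _).trans (hα _ _ _ _)

end IsAdditiveExtension

end AdditiveExtension

/-! ### Left adjoints of additive restriction and products -/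

section TensorComparison

universe v₁ u₁ v₂ u₂

variable {C : Type u₁} [Category.{v₁} C] {D : Type u₂} [Category.{v₂} D] [Preadditive D]
  {K : C ⥤ D} {L : (C ⥤ AddCommGrpCat.{w}) ⥤ (D ⥤+ AddCommGrpCat.{w})}
  (adj : L ⊣ additiveRestriction.{w} K)

/-- The unit of a left adjoint of additive restriction. -/
def additiveUnit (X : C ⥤ AddCommGrpCat.{w}) : X ⟶ K ⋙ (L.obj X).obj := adj.unit.app X

theorem additiveUnit_naturality {X Y : C ⥤ AddCommGrpCat.{w}} (f : X ⟶ Y) (c : C) (x : X.obj c) :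
    (L.map f).hom.app (K.obj c) ((additiveUnit adj X).app c x) =
      (additiveUnit adj Y).app c (f.app c x) :=
  (ConcreteCategory.congr_hom (NatTrans.congr_app (adj.unit.naturality f) c) x).symm

/-- Additive functors form a full subcategory, so the hom-set bijection of `adj` is exactly this
universal property. -/
theorem isAdditiveExtension_additiveUnit (X : C ⥤ AddCommGrpCat.{w}) :
    IsAdditiveExtension (additiveUnit adj X) := by
  intro Q _
  have h := (adj.homEquiv X (AdditiveFunctor.of Q)).bijective
  have key (φ : L.obj X ⟶ AdditiveFunctor.of Q) :
      adj.homEquiv X (AdditiveFunctor.of Q) φ =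
        additiveUnit adj X ≫ Functor.whiskerLeft K φ.hom :=
    adj.homEquiv_unit _ _ _
  constructor
  · intro φ ψ hφ
    have : (⟨φ⟩ : L.obj X ⟶ AdditiveFunctor.of Q) = ⟨ψ⟩ := h.1 (by rw [key, key]; exact hφ)
    exact congrArg InducedCategory.Hom.hom this
  · intro ψ
    obtain ⟨φ, hφ⟩ := h.2 ψ
    exact ⟨φ.hom, (key φ).symm.trans hφ⟩

/-- The external tensor product of two units. -/
noncomputable def externalUnit (X : (C ⥤ AddCommGrpCat.{w}) × (C ⥤ AddCommGrpCat.{w})) :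
    (externalTensor C C).obj X ⟶
      K.prod K ⋙ (externalTensor D D).obj ((L.obj X.1).obj, (L.obj X.2).obj) :=
  externalTensorMap (additiveUnit adj X.1) (additiveUnit adj X.2)

variable {prodC : C × C ⥤ C} {prodD : D × D ⥤ D} (e : K.prod K ⋙ prodD ≅ prodC ⋙ K)
  {LC : (C × C ⥤ AddCommGrpCat.{w}) ⥤ (C ⥤ AddCommGrpCat.{w})}
  (adjC : LC ⊣ (Functor.whiskeringLeft _ _ AddCommGrpCat.{w}).obj prodC)
  {LD : (D × D ⥤ AddCommGrpCat.{w}) ⥤ (D ⥤+ AddCommGrpCat.{w})}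
  (adjD : LD ⊣ additiveRestriction.{w} prodD)

/-- The morphism of two variable functors which corresponds to a morphism out of a box product. -/
noncomputable def boxTranspose {X : (C ⥤ AddCommGrpCat.{w}) × (C ⥤ AddCommGrpCat.{w})}
    {P : D ⥤+ AddCommGrpCat.{w}}
    (g : LD.obj ((externalTensor D D).obj ((L.obj X.1).obj, (L.obj X.2).obj)) ⟶ P) :
    (externalTensor C C).obj X ⟶ prodC ⋙ K ⋙ P.obj :=
  externalUnit adj X ≫ Functor.whiskerLeft (K.prod K) (adjD.homEquiv _ P g) ≫
    Functor.whiskerRight e.hom P.obj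

theorem boxTranspose_comp {X : (C ⥤ AddCommGrpCat.{w}) × (C ⥤ AddCommGrpCat.{w})}
    {P Q : D ⥤+ AddCommGrpCat.{w}}
    (g : LD.obj ((externalTensor D D).obj ((L.obj X.1).obj, (L.obj X.2).obj)) ⟶ P) (h : P ⟶ Q) :
    boxTranspose adj e adjD (g ≫ h) = boxTranspose adj e adjD g ≫
      ((Functor.whiskeringLeft _ _ AddCommGrpCat.{w}).obj prodC).map
        ((additiveRestriction K).map h) := by
  rw [boxTranspose, boxTranspose, adjD.homEquiv_naturality_right]
  ext p : 2
  simp only [NatTrans.comp_app, Category.assoc]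
  refine congrArg ((externalUnit adj X).app p ≫ ·) ((Category.assoc _ _ _).trans
    (congrArg ((adjD.homEquiv _ P g).app ((K.prod K).obj p) ≫ ·) ?_))
  exact (h.hom.naturality (e.hom.app p)).symm

theorem boxTranspose_naturality {X Y : (C ⥤ AddCommGrpCat.{w}) × (C ⥤ AddCommGrpCat.{w})}
    (f : X ⟶ Y) {P : D ⥤+ AddCommGrpCat.{w}}
    (g : LD.obj ((externalTensor D D).obj ((L.obj Y.1).obj, (L.obj Y.2).obj)) ⟶ P) :
    (externalTensor C C).map f ≫ boxTranspose adj e adjD g =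
      boxTranspose adj e adjD (X := X) (LD.map ((externalTensor D D).map
        (X := ((L.obj X.1).obj, (L.obj X.2).obj)) (Y := ((L.obj Y.1).obj, (L.obj Y.2).obj))
        ((L.map f.1).hom, (L.map f.2).hom)) ≫ g) := by
  rw [boxTranspose, boxTranspose, adjD.homEquiv_naturality_left]
  refine externalTensor_hom_ext fun c d x y => ?_
  refine congrArg (fun t => P.obj.map (e.hom.app (c, d))
    ((adjD.homEquiv _ P g).app (K.obj c, K.obj d) t)) ?_
  exact congrArg₂ extTmul (additiveUnit_naturality adj f.1 c x).symm
    (additiveUnit_naturality adj f.2 d y).symm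

/-- A composite of three bijections: the adjunction defining the box product, the universal property
of the two units, and composition with `e`. The hypotheses `hl` and `hr` make `prodD ⋙ P.obj`
additive in each variable. -/
theorem boxTranspose_bijective (hl : ∀ d, (Prod.sectL D d ⋙ prodD).Additive)
    (hr : ∀ d, (Prod.sectR d D ⋙ prodD).Additive)
    (X : (C ⥤ AddCommGrpCat.{w}) × (C ⥤ AddCommGrpCat.{w})) (P : D ⥤+ AddCommGrpCat.{w}) :
    Function.Bijective (boxTranspose adj e adjD (X := X) (P := P)) := by
  have h₁ := (isAdditiveExtension_additiveUnit adj X.1).externalTensor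
    (isAdditiveExtension_additiveUnit adj X.2) (prodD ⋙ P.obj)
    (fun d => have := hl d; inferInstanceAs ((Prod.sectL D d ⋙ prodD) ⋙ P.obj).Additive)
    (fun d => have := hr d; inferInstanceAs ((Prod.sectR d D ⋙ prodD) ⋙ P.obj).Additive)
  have h₂ := ((Functor.isoWhiskerRight e P.obj).homToEquiv
    (Z := (externalTensor C C).obj X)).bijective
  exact h₂.comp (h₁.comp (adjD.homEquiv _ P).bijective)

/-- A left adjoint of additive restriction along a functor which preserves products takes
convolution products to convolution products. -/
noncomputable def convolutionIso (hl : ∀ d, (Prod.sectL D d ⋙ prodD).Additive)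
    (hr : ∀ d, (Prod.sectR d D ⋙ prodD).Additive) :
    externalTensor C C ⋙ LC ⋙ L ≅
      L.prod L ⋙ (AdditiveFunctor.forget D AddCommGrpCat.{w}).prod (AdditiveFunctor.forget D _) ⋙
        externalTensor D D ⋙ LD :=
  have hiso (X : (C ⥤ AddCommGrpCat.{w}) × (C ⥤ AddCommGrpCat.{w})) :
      IsIso (((adjC.comp adj).homEquiv ((externalTensor C C).obj X) _).symm
        (boxTranspose adj e adjD (X := X) (𝟙 _))) := by
    -- Yoneda: precomposition with the candidate, followed by the hom-set bijection of the composite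
    -- adjunction, is `boxTranspose`.
    refine isIso_of_coyoneda_map_bijective _ fun P => ?_
    refine (Function.Bijective.of_comp_iff'
      ((adjC.comp adj).homEquiv ((externalTensor C C).obj X) P).bijective _).1 ?_
    refine Eq.mp (congrArg _ (funext fun g => ?_))
      (boxTranspose_bijective adj e adjD hl hr X P)
    rw [Function.comp_apply, Adjunction.homEquiv_naturality_right, Equiv.apply_symm_apply]
    refine Eq.trans ?_ (boxTranspose_comp adj e adjD (𝟙 _) g)
    rw [Category.id_comp]
  NatIso.ofComponents (fun X => @asIso _ _ _ _ _ (hiso X)) fun {X Y} f => by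
    -- Both sides of the naturality square are transposes of `boxTranspose` applied to the same map
    -- of box products.
    refine ((adjC.comp adj).homEquiv_naturality_left_symm ((externalTensor C C).map f)
      (boxTranspose adj e adjD (X := Y) (𝟙 _))).symm.trans ?_
    rw [boxTranspose_naturality, Category.comp_id, ← Category.id_comp (LD.map _),
      boxTranspose_comp]
    exact (adjC.comp adj).homEquiv_naturality_right_symm _ _

end TensorComparison

/-! ### The Burnside category as an instance, and the conclusion -/

namespace CoeffSys

open FinGSet

variable (G : Type u) [Group G]

/-- The extension of the orbit restriction of an additive functor is its restriction to finite
`G`-sets. -/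
noncomputable def restrictionExtendIso :
    additiveRestriction.{w} (BurnsideCat.ofOp (G := G)) ≅
      additiveRestriction.{w} ((isOrbit G).ι.op ⋙ BurnsideCat.ofOp) ⋙ extend G :=
  NatIso.ofComponents
    (fun P => asIso ((restrictAdjunction G).unit.app (BurnsideCat.ofOp ⋙ P.obj)))
    fun f => (restrictAdjunction G).unit.naturality (Functor.whiskerLeft BurnsideCat.ofOp f.hom)

variable [Finite G]

/-- The additive left Kan extension from finite `G`-sets to the Burnside category. -/
noncomputable def restrictToMackeyAdjunction :
    restrict.{w} G ⋙ toMackey G ⊣ additiveRestriction.{w} (BurnsideCat.ofOp (G := G)) :=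
  -- The composite adjunction has right adjoint "restrict to orbits, then extend", which is replaced
  -- by the isomorphic restriction along `ofOp`.
  ((restrictAdjunction G).comp (additiveLanAdjunction _)).ofNatIsoRight
    (restrictionExtendIso G).symm

/-- The inclusion of finite `G`-sets in the Burnside category preserves cartesian products. -/
noncomputable def ofOpProdIso :
    (BurnsideCat.ofOp (G := G)).prod BurnsideCat.ofOp ⋙ BurnsideCat.prod ≅
      prodOp ⋙ BurnsideCat.ofOp :=
  -- The objects agree by definition, and the product of two spans whose right legs are identities
  -- is again of this form.
  NatIso.ofComponents (fun _ => Iso.refl _) fun f =>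
    (Category.comp_id _).trans (Eq.trans (BurnsideHom.prod_of _ _)
      (Category.id_comp ((prodOp ⋙ BurnsideCat.ofOp).map f)).symm)

/-- Biadditivity of the product is what makes `P(- × -)` additive in each variable for every Mackey
functor `P`. -/
instance (T : BurnsideCat G) : (Prod.sectL (BurnsideCat G) T ⋙ BurnsideCat.prod).Additive where
  map_add {_ _ f g} := DFunLike.congr_fun (map_add BurnsideHom.prod f g) _

instance (S : BurnsideCat G) : (Prod.sectR S (BurnsideCat G) ⋙ BurnsideCat.prod).Additive where
  map_add {_ _ f g} := map_add (BurnsideHom.prod _) f g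

end CoeffSys

theorem mainTheorem6 (G : Type u) [Group G] [Finite G] :
    Nonempty (CoeffSys.boxTimes.{w} G ⋙ CoeffSys.toMackey.{w} G ≅
      (CoeffSys.toMackey.{w} G).prod (CoeffSys.toMackey.{w} G) ⋙ Mackey.box.{w} G) := by
  have : IsIso (CoeffSys.restrictAdjunction.{w} G).counit :=
    NatIso.isIso_of_isIso_app _
  let i : CoeffSys.extend.{w} G ⋙ CoeffSys.restrict G ⋙ CoeffSys.toMackey G ≅
      CoeffSys.toMackey G :=
    Functor.isoWhiskerRight (asIso (CoeffSys.restrictAdjunction G).counit) (CoeffSys.toMackey G)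
  let j := convolutionIso (CoeffSys.restrictToMackeyAdjunction.{w} G) (CoeffSys.ofOpProdIso G)
    (FinGSet.prodOp.lanAdjunction AddCommGrpCat.{w}) (additiveLanAdjunction BurnsideCat.prod)
    inferInstance inferInstance
  -- Evaluated at pairs of extended coefficient systems, the source of `j` is `boxTimes` followed by
  -- `toMackey` by definition, and `i` simplifies both factors of its target.
  exact ⟨Functor.isoWhiskerLeft ((CoeffSys.extend G).prod (CoeffSys.extend G)) j ≪≫
    Functor.isoWhiskerRight (NatIso.prod i i) (Mackey.box G)⟩
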